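/- Let $\mathfrak{o}$ be a complete discrete valuation ring with maximal ideal $\mathfrak{p}$ and finite residue field, let $\ell\in\mathbb{N}$ and $\mathfrak{o}_\ell=\mathfrak{o}/\mathfrak{p}^\ell$. Let $R$ be a finite, not necessarily commutative, $\mathfrak{o}_\ell$-algebra, let $M_1,\dots,M_k$ be finite indecomposable left $R$-modules, and let $\mathcal{C}=\langle M_1,\dots,M_k\rangle$ be the full subcategory of the category of left $R$-modules whose objects are the modules isomorphic to $\bigoplus_{i=1}^k M_i^{a_i}$ for some $a_1,\dots,a_k\in\mathbb{N}$. Let $\mathcal{C}_{+1}$ be the category of $\mathfrak{o}_\ell$-linear functors from $\mathcal{C}$ to finite $\mathfrak{o}_\ell$-modules. For $F,G\in\mathcal{C}_{+1}$ write $G\prec F$ if $G$ is isomorphic to a subquotient of $F$ and $G\not\cong F$. Let $K$ be an algebraically closed field of characteristic zero. For $F\in\mathcal{C}_{+1}$ and $M\in\mathcal{C}$ let $KF(M)$ be the $K$-vector space with basis $\{u_m\mid m\in F(M)\}$, on which $g\in\mathrm{Aut}_R(M)$ acts by $u_m\mapsto u_{F(g)(m)}$. A natural automorphism $\alpha$ of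 $F$ induces the automorphism $\alpha_*:u_m\mapsto u_{\alpha_M(m)}$ of the representation $KF(M)$. **Theorem.** Let $F\in\mathcal{C}_{+1}$. 1. For every $M\in\mathcal{C}$, among the subrepresentations $W$ of $KF(M)$ with $\mathrm{Hom}_{\mathrm{Aut}_R(M)}(KG(M),W)=0$ for all $G\prec F$ there is a largest one, denoted $\overline{KF(M)}$. It is stable under all the maps $\alpha_*$, and the resulting $K$-algebra homomorphism $$\Phi_F(M):K\mathrm{Aut}_{\mathcal{C}_{+1}}(F)\to\mathrm{End}_{\mathrm{Aut}_R(M)}\bigl(\overline{KF(M)}\bigr),\qquad \alpha\mapsto\alpha_*|_{\overline{KF(M)}},$$ is surjective. 2. There is a constant $c\in\mathbb{N}$ such that $\Phi_F(M)$ is also injective for every $M\cong\bigoplus_{i=1}^k M_i^{a_i}$ with $a_i\ge c$ for all $i$. -/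

import Mathlib

open CategoryTheory

universe u v w t s

namespace FunctorMorphing

noncomputable section

section Categories

variable {R : Type v} [Ring R] {k : ℕ}

/-- `X` is isomorphic to the direct sum of `a i` copies of `N i`, for `i` in `Fin k`. -/
def HasMultiplicities (N : Fin k → ModuleCat.{w} R) (X : ModuleCat.{w} R) (a : Fin k → ℕ) : Prop :=
  Nonempty (X ≃ₗ[R] ((i : Fin k) → Fin (a i) → N i))

/-- The property of being isomorphic to a finite direct sum of copies of the modules `N i`. -/
def IsSumOf (N : Fin k → ModuleCat.{w} R) : ObjectProperty (ModuleCat.{w} R) :=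
  fun X => ∃ a : Fin k → ℕ, HasMultiplicities N X a

/-- The full subcategory `𝒞 = ⟨N 0, …, N (k - 1)⟩` of the category of left `R`-modules. -/
abbrev SumCat (N : Fin k → ModuleCat.{w} R) := (IsSumOf N).FullSubcategory

variable (A : Type u) [CommRing A] [Algebra A R] {N : Fin k → ModuleCat.{w} R}

variable {A} in
/-- The scalar multiple `r • f : x ↦ r • f x` of a morphism of `𝒞`, for `r` in the base ring `A` of
the algebra `R`. -/
def scalarMul {X Y : SumCat N} (r : A) (f : X ⟶ Y) : X ⟶ Y :=
  ObjectProperty.homMk (ModuleCat.ofHom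
    { toFun := fun x => algebraMap A R r • f.hom.hom x
      map_add' := fun x y => by rw [map_add, smul_add]
      map_smul' := fun c x => by
        rw [map_smul, RingHom.id_apply, smul_smul, smul_smul, Algebra.commutes] })

/-- The property of being an `A`-linear functor from `𝒞` with values in finite `A`-modules. -/
structure IsFiniteLinear (F : SumCat N ⥤ ModuleCat.{t} A) : Prop where
  finite_obj : ∀ X, Finite (F.obj X)
  map_add : ∀ {X Y : SumCat N} (f g : X ⟶ Y), F.map (f + g) = F.map f + F.map g
  map_scalarMul : ∀ {X Y : SumCat N} (r : A) (f : X ⟶ Y), F.map (scalarMul r f) = r • F.map f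

variable (N) in
/-- `IsFiniteLinear` as a property of the objects of the functor category. -/
def finiteLinear : ObjectProperty (SumCat N ⥤ ModuleCat.{t} A) := fun F => IsFiniteLinear A F

variable (N) in
/-- The category `𝒞₊₁` of `A`-linear functors from `𝒞` to finite `A`-modules, with all natural
transformations as morphisms. -/
abbrev FunctorCat := (finiteLinear.{u, v, w, t} A N).FullSubcategory

variable {A}

/-- `F ≼ G`: the functor `F` is isomorphic to a subquotient of `G`, that is, to a quotient of a
subfunctor `H` of `G`. -/
def IsSubquotient (F G : FunctorCat.{u, v, w, t} A N) : Prop :=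
  ∃ (H : FunctorCat.{u, v, w, t} A N) (i : H ⟶ G) (p : H ⟶ F),
    (∀ X, Function.Injective (i.hom.app X)) ∧ (∀ X, Function.Surjective (p.hom.app X))

/-- `F ≺ G`: the functor `F` is isomorphic to a subquotient of `G`, but not to `G`. -/
def StrictlyBelow (F G : FunctorCat.{u, v, w, t} A N) : Prop :=
  IsSubquotient F G ∧ ¬ Nonempty (F ≅ G)

end Categories

section Representations

variable {R : Type v} [Ring R] {k : ℕ} {N : Fin k → ModuleCat.{w} R}
  {A : Type u} [CommRing A] [Algebra A R]
  (K : Type s) [Field K]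

/-- The permutation representation `K F(M)` of `Aut_R(M)`: it has the basis `F(M)`, and `g` sends
the basis vector `u_m` to `u_{F(g)(m)}`. -/
def permRep (F : FunctorCat.{u, v, w, t} A N) (M : SumCat N) :
    Representation K (Aut M) (F.obj.obj M →₀ K) where
  toFun g := Finsupp.lmapDomain K K (F.obj.map g.hom)
  map_one' := by
    ext m : 2
    simp [show (1 : Aut M) = Iso.refl M from rfl]
  map_mul' g h := by
    ext m : 2
    have e : (g * h).hom = h.hom ≫ g.hom := rfl
    simp [e]

/-- The map `α_* : K F(M) → K G(M)` induced by a natural transformation, `u_m ↦ u_{α_M(m)}`. -/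
def pushforward {F G : FunctorCat.{u, v, w, t} A N} (α : F ⟶ G) (M : SumCat N) :
    (permRep K F M).IntertwiningMap (permRep K G M) where
  toLinearMap := Finsupp.lmapDomain K K (α.hom.app M)
  isIntertwining' g := by
    ext m : 2
    simp [permRep]

theorem pushforward_id (F : FunctorCat.{u, v, w, t} A N) (M : SumCat N) (x : F.obj.obj M →₀ K) :
    pushforward K (𝟙 F) M x = x := by
  change Finsupp.lmapDomain K K _ x = x
  simp

theorem pushforward_comp {F G H : FunctorCat.{u, v, w, t} A N} (α : F ⟶ G) (β : G ⟶ H)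
    (M : SumCat N) (x : F.obj.obj M →₀ K) :
    pushforward K (α ≫ β) M x = pushforward K β M (pushforward K α M x) := by
  change Finsupp.mapDomain _ x = Finsupp.mapDomain _ (Finsupp.mapDomain _ x)
  rw [← Finsupp.mapDomain_comp]
  rfl

variable {K}

/-- There are no non-zero maps of representations from `K G(M)` to `W`, for any `G ≺ F`. -/
def NoMapsFromBelow {F : FunctorCat.{u, v, w, t} A N} {M : SumCat N}
    (W : Subrepresentation (permRep K F M)) : Prop :=
  ∀ G : FunctorCat.{u, v, w, t} A N, StrictlyBelow G F →
    ∀ φ : (permRep K G M).IntertwiningMap W.toRepresentation, φ = 0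

variable (K)

/-- The representation `\overline{K F(M)}`: the join of all the subrepresentations of `K F(M)` that
receive no non-zero map from `K G(M)` for any `G ≺ F`. -/
def barRep (F : FunctorCat.{u, v, w, t} A N) (M : SumCat N) :
    Subrepresentation (permRep K F M) where
  toSubmodule := ⨆ W : {W : Subrepresentation (permRep K F M) // NoMapsFromBelow W},
    W.1.toSubmodule
  apply_mem_toSubmodule g v hv := by
    suffices h : (⨆ W : {W : Subrepresentation (permRep K F M) // NoMapsFromBelow W},
        W.1.toSubmodule) ≤ Submodule.comap (permRep K F M g)
          (⨆ W : {W : Subrepresentation (permRep K F M) // NoMapsFromBelow W},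
            W.1.toSubmodule) from h hv
    refine iSup_le fun W x hx => ?_
    exact Submodule.mem_iSup_of_mem W (W.1.apply_mem_toSubmodule g hx)

theorem pushforward_mem_barRep {F : FunctorCat.{u, v, w, t} A N} (α : Aut F) (M : SumCat N)
    {x : F.obj.obj M →₀ K} (hx : x ∈ (barRep K F M).toSubmodule) :
    pushforward K α.hom M x ∈ (barRep K F M).toSubmodule := by
  have hinv : ∀ y : F.obj.obj M →₀ K, pushforward K α.inv M (pushforward K α.hom M y) = y := by
    intro y
    rw [← pushforward_comp, α.hom_inv_id, pushforward_id]
  have hinv' : ∀ y : F.obj.obj M →₀ K, pushforward K α.hom M (pushforward K α.inv M y) = y := by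
    intro y
    rw [← pushforward_comp, α.inv_hom_id, pushforward_id]
  suffices h : (barRep K F M).toSubmodule ≤
      Submodule.comap (pushforward K α.hom M).toLinearMap (barRep K F M).toSubmodule from h hx
  refine iSup_le fun W => ?_
  intro y hy
  let W' : Subrepresentation (permRep K F M) :=
    { toSubmodule := Submodule.comap (pushforward K α.inv M).toLinearMap W.1.toSubmodule
      apply_mem_toSubmodule := fun g v hv => by
        have h := W.1.apply_mem_toSubmodule g hv
        rw [Submodule.mem_comap]
        rw [Representation.IntertwiningMap.toLinearMap_apply] at h ⊢
        rwa [Representation.IntertwiningMap.isIntertwining] }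
  have hW' : NoMapsFromBelow W' := by
    intro G hG φ
    have h0 := W.2 G hG
      { toLinearMap := ((pushforward K α.inv M).toLinearMap.restrict
          (p := W'.toSubmodule) (q := W.1.toSubmodule) (fun _ h => h)) ∘ₗ φ.toLinearMap
        isIntertwining' := by
          intro g
          refine LinearMap.ext fun z => Subtype.ext ?_
          have h1 : φ (permRep K G M g z) = W'.toRepresentation g (φ z) := φ.isIntertwining _ _ g z
          change pushforward K α.inv M (φ (permRep K G M g z)).1 = _
          rw [h1]
          exact (pushforward K α.inv M).isIntertwining _ _ g (φ z).1 }
    refine Representation.IntertwiningMap.ext (LinearMap.ext fun z => Subtype.ext ?_)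
    have h2 : pushforward K α.inv M (φ z).1 = 0 :=
      congrArg Subtype.val (DFunLike.congr_fun h0 z)
    have h3 := hinv' (φ z).1
    rw [h2, map_zero] at h3
    exact h3.symm
  refine Submodule.mem_iSup_of_mem ⟨W', hW'⟩ ?_
  change pushforward K α.inv M (pushforward K α.hom M y) ∈ W.1.toSubmodule
  rwa [hinv]

/-- The algebra homomorphism `Φ_F(M) : K Aut(F) → End(\overline{K F(M)})` that sends the basis vector
of `α` to the restriction of `α_*`. -/
def Phi (F : FunctorCat.{u, v, w, t} A N) (M : SumCat N) :
    MonoidAlgebra K (Aut F) →ₐ[K]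
      (barRep K F M).toRepresentation.IntertwiningMap (barRep K F M).toRepresentation :=
  MonoidAlgebra.lift K _ (Aut F)
    { toFun := fun α =>
        { toLinearMap := (pushforward K α.hom M).toLinearMap.restrict
            (fun _ hx => pushforward_mem_barRep K α M hx)
          isIntertwining' := fun g => by
            refine LinearMap.ext fun x => Subtype.ext ?_
            exact (pushforward K α.hom M).isIntertwining _ _ g x.1 }
      map_one' := by
        refine Representation.IntertwiningMap.ext (LinearMap.ext fun x => Subtype.ext ?_)
        exact pushforward_id K F M x.1
      map_mul' := fun α β => by
        refine Representation.IntertwiningMap.ext (LinearMap.ext fun x => Subtype.ext ?_)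
        exact pushforward_comp K β.hom α.hom M x.1 }

end Representations

end

end FunctorMorphing

/-! The matrix of an intertwining map `K F(M) → K G(M)` is a function on `F(M) × G(M)` invariant
under `Aut(M)`, the unit group of the finite ring `End(M)`. Finite rings have stable range one, so
two generators of the same cyclic module differ by a unit (`exists_units_smul_eq`). By Möbius
inversion over the lattice of submodules, invariant functions are then combinations of indicators of
`End(M)`-submodules: intertwining maps are spanned by linear relations (`intertwiningMap_mem_span`).

A relation `L` on `F(M)` extends to a natural family of relations. Its core, the codomain modulo the
indeterminacy, is a subquotient of `F`. If the core is isomorphic to `F`, counting shows that `L` is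
the graph of an automorphism of `F`. Otherwise the map of `L` factors, up to a nonzero scalar,
through a functor strictly below `F`. By semisimplicity, receiving no maps from such functors is the
same as being killed by all maps to them. This yields the largest subrepresentation, and on it only
graphs of automorphisms survive, whence surjectivity.

For injectivity, an element of the group algebra acting as zero on the largest subrepresentation
acts on `K F(M)` as a sum of maps through smaller functors (`mem_belowSpan`). These are combinations
of composite relations, none of which is the graph of an automorphism. When the multiplicities are
large, every submodule of `F(M) × F(M)` is cyclic (`exists_span_singleton_eq`), so the maps of
distinct relations are linearly independent. A combination of graphs that is also a combination of
non-graphs is therefore trivial. -/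

namespace FunctorMorphing

/-! ### Stable range one for finite rings. -/

section StableRange

variable {S : Type*} [Ring S] [Finite S]

/-- A finite ring is Dedekind-finite, so a left inverse is two-sided. -/
theorem isUnit_of_span_singleton_eq_top {x : S} (h : Ideal.span {x} = ⊤) : IsUnit x := by
  obtain ⟨y, hy⟩ := Ideal.mem_span_singleton'.1 (h ▸ Submodule.mem_top : (1 : S) ∈ Ideal.span {x})
  exact ⟨⟨x, y, mul_eq_one_symm hy, hy⟩, rfl⟩

/-- If `x` does not generate the unit ideal of a finite semisimple ring, but does so together with
the left ideal `I`, then some translate of `x` by `I` has a smaller left annihilator. -/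
theorem exists_annihilator_lt [IsSemisimpleRing S] {x : S} {I : Ideal S}
    (hx : Ideal.span {x} ⊔ I = ⊤) (hne : Ideal.span {x} ≠ ⊤) :
    ∃ c ∈ I, {s : S | s * (x + c) = 0} ⊂ {s : S | s * x = 0} := by
  -- Intersecting `D` with `I` gives a complement `C` of `Sx ∩ I` inside `I`, so that `S = Sx ⊕ C`.
  obtain ⟨D, hD⟩ := exists_isCompl (Ideal.span {x} ⊓ I)
  set C : Ideal S := D ⊓ I with hC
  have hdisj : Ideal.span {x} ⊓ C = ⊥ := by
    rw [hC, inf_comm D, ← inf_assoc]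
    exact hD.inf_eq_bot
  have hCtop : Ideal.span {x} ⊔ C = ⊤ := by
    have hI : (Ideal.span {x} ⊓ I) ⊔ C = I := by
      rw [hC, ← sup_inf_assoc_of_le D (inf_le_right : Ideal.span {x} ⊓ I ≤ I), hD.sup_eq_top,
        top_inf_eq]
    rw [eq_top_iff, ← hx]
    refine sup_le le_sup_left ?_
    conv_lhs => rw [← hI]
    exact sup_le_sup_right inf_le_left _
  have hz : ∀ z, z ∈ Ideal.span {x} → z ∈ C → z = 0 := fun z h1 h2 => by
    have : z ∈ Ideal.span {x} ⊓ C := ⟨h1, h2⟩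
    rwa [hdisj] at this
  have hmx : ∀ r : S, r * x ∈ Ideal.span {x} := fun r => Ideal.mem_span_singleton'.2 ⟨r, rfl⟩
  obtain ⟨y, hy, c₀, hc₀, h1⟩ :=
    Submodule.mem_sup.1 (hCtop ▸ Submodule.mem_top : (1 : S) ∈ Ideal.span {x} ⊔ C)
  obtain ⟨b, rfl⟩ := Ideal.mem_span_singleton'.1 hy
  have hxc : x * c₀ = 0 := by
    refine hz _ ?_ (C.mul_mem_left x hc₀)
    have : x * c₀ = (1 - x * b) * x := by
      rw [← eq_sub_iff_add_eq'] at h1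
      rw [h1]; noncomm_ring
    rw [this]
    exact hmx _
  have hc0 : c₀ ≠ 0 := by
    rintro rfl
    refine hne ((Ideal.eq_top_iff_one _).2 ?_)
    rw [← h1, add_zero]
    exact hmx b
  -- Multiplication by `x` kills `c₀ ≠ 0` in the finite module `C`, so it also misses some `c₁`.
  -- This `c₁` is the required translate.
  let m : C → C := fun c => ⟨x * c, C.mul_mem_left x c.2⟩
  have hm : ¬ Function.Injective m := fun hinj => by
    have : (⟨c₀, hc₀⟩ : C) = 0 := hinj (Subtype.ext (by simp [m, hxc]))
    exact hc0 (congrArg Subtype.val this)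
  rw [Finite.injective_iff_surjective] at hm
  simp only [Function.Surjective, not_forall, not_exists] at hm
  obtain ⟨⟨c₁, hc₁⟩, hm⟩ := hm
  have hker : ∀ s, s * (x + c₁) = 0 → s * x = 0 ∧ s * c₁ = 0 := fun s hs => by
    rw [mul_add] at hs
    have h2 : s * x = 0 := hz _ (hmx s) (by
      rw [eq_neg_of_add_eq_zero_left hs]
      exact C.neg_mem (C.mul_mem_left s hc₁))
    exact ⟨h2, by rwa [h2, zero_add] at hs⟩
  refine ⟨c₁, hc₁.2, ⟨fun s hs => (hker s hs).1, fun hle => ?_⟩⟩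
  refine hm ⟨b * c₁, C.mul_mem_left b hc₁⟩ (Subtype.ext ?_)
  -- The element `xb - 1` separates the two annihilators: if it also killed `x + c₁`, then `c₁ =
  -- x(bc₁)` would be in the image of `m`.
  have h3 : (x * b - 1) * x = 0 := by
    have : (x * b - 1) * x = x * (b * x + c₀) - x * c₀ - x := by noncomm_ring
    rw [this, h1, hxc]; simp
  have h4 := (hker _ (hle h3)).2
  change x * (b * c₁) = c₁
  rwa [sub_mul, one_mul, sub_eq_zero, mul_assoc] at h4

/-- A translate of `a` by `I` with minimal left annihilator must generate the unit ideal, since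
otherwise `exists_annihilator_lt` would shrink the annihilator further. -/
theorem exists_isUnit_add_of_isSemisimpleRing [IsSemisimpleRing S] {a : S} {I : Ideal S}
    (ha : Ideal.span {a} ⊔ I = ⊤) : ∃ i ∈ I, IsUnit (a + i) := by
  obtain ⟨i, hi, hmin⟩ := WellFounded.has_min
    (r := InvImage (· < ·) fun i : S => {s : S | s * (a + i) = 0}) (InvImage.wf _ wellFounded_lt)
    (I : Set S) ⟨0, I.zero_mem⟩
  refine ⟨i, hi, isUnit_of_span_singleton_eq_top ?_⟩
  by_contra hne
  have hx : Ideal.span {a + i} ⊔ I = ⊤ := by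
    rw [eq_top_iff, ← ha]
    refine sup_le ?_ le_sup_right
    rw [Ideal.span_singleton_le_iff_mem]
    exact Submodule.mem_sup.2 ⟨a + i, Ideal.mem_span_singleton_self _, -i, I.neg_mem hi, by abel⟩
  obtain ⟨c, hc, hlt⟩ := exists_annihilator_lt hx hne
  refine hmin (i + c) (I.add_mem hi hc) ?_
  change {s : S | s * (a + (i + c)) = 0} ⊂ {s : S | s * (a + i) = 0}
  rwa [← add_assoc]

/-- Finite rings have stable range one. -/
theorem exists_isUnit_add {a : S} {I : Ideal S} (ha : Ideal.span {a} ⊔ I = ⊤) :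
    ∃ i ∈ I, IsUnit (a + i) := by
  let π := Ideal.Quotient.mk (Ring.jacobson S)
  have hπ : Function.Surjective π := Ideal.Quotient.mk_surjective
  have : Finite (S ⧸ Ring.jacobson S) := Finite.of_surjective _ hπ
  have : IsSemisimpleRing (S ⧸ Ring.jacobson S) := IsSemiprimaryRing.isSemisimpleRing
  have ha' : Ideal.span {π a} ⊔ I.map π = ⊤ := by
    rw [← Ideal.map_top π, ← ha, Ideal.map_sup, Ideal.map_span, Set.image_singleton]
  obtain ⟨i', hi', hu⟩ := exists_isUnit_add_of_isSemisimpleRing ha'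
  obtain ⟨i, hi, rfl⟩ := (Ideal.mem_map_iff_of_surjective π hπ).1 hi'
  refine ⟨i, hi, isUnit_of_span_singleton_eq_top ?_⟩
  by_contra hne
  -- A maximal left ideal containing `a + i` also contains the Jacobson radical, modulo which `a +
  -- i` is invertible, so it contains 1.
  obtain ⟨m, hm, hle⟩ := Ideal.exists_le_maximal _ hne
  obtain ⟨y', hy'⟩ := hu.exists_left_inv
  obtain ⟨y, rfl⟩ := hπ y'
  rw [← map_add, ← map_mul, ← map_one π, Ideal.Quotient.eq] at hy'
  have hJ : Ring.jacobson S ≤ m := sInf_le (Ideal.isMaximal_def.1 hm)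
  have h1 : y * (a + i) ∈ m := m.mul_mem_left y (hle (Ideal.mem_span_singleton_self _))
  refine hm.ne_top ((Ideal.eq_top_iff_one m).2 ?_)
  have := m.sub_mem h1 (hJ hy')
  rwa [sub_sub_cancel] at this

variable {V : Type*} [AddCommGroup V] [Module S V]

/-- Two generators of a cyclic module over a finite ring differ by a unit. -/
theorem exists_units_smul_eq {v w : V} (h : Submodule.span S {v} = Submodule.span S {w}) :
    ∃ u : Sˣ, u • v = w := by
  obtain ⟨a, rfl⟩ := Submodule.mem_span_singleton.1 (h ▸ Submodule.mem_span_singleton_self w)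
  obtain ⟨b, hb⟩ := Submodule.mem_span_singleton.1 (h ▸ Submodule.mem_span_singleton_self v)
  -- Here `w = av` and `v = bav`, so `1 - ba` annihilates `v`. Changing `a` by an annihilator of `v`
  -- does not affect `av`.
  obtain ⟨i, hi, u, hu⟩ := exists_isUnit_add (a := a)
    (I := LinearMap.ker (LinearMap.toSpanSingleton S V v)) (by
      refine (Ideal.eq_top_iff_one _).2 (Submodule.mem_sup.2
        ⟨b * a, Ideal.mem_span_singleton'.2 ⟨b, rfl⟩, 1 - b * a, ?_, by abel⟩)
      simp [sub_smul, mul_smul, hb])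
  refine ⟨u, ?_⟩
  rw [Units.smul_def, hu, add_smul]
  simpa using hi

end StableRange

/-! ### Indicator functions of submodules. -/

section Indicators

variable {S : Type*} [Ring S] {V : Type*} [AddCommGroup V] [Module S V] (K : Type*) [Field K]

open Classical in
/-- The indicator function of a submodule. -/
noncomputable def submoduleIndicator (L : Submodule S V) : V → K :=
  fun x => if x ∈ L then 1 else 0

variable (S)

open Classical in
/-- The indicator function of the set of generators of a submodule lies in the span of the
indicator functions of submodules. -/
theorem generators_indicator_mem_span [Finite V] (L : Submodule S V) :
    (fun x : V => if Submodule.span S {x} = L then (1 : K) else 0) ∈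
      Submodule.span K (Set.range (submoduleIndicator (S := S) (V := V) K)) := by
  have : Finite (Submodule S V) := Finite.of_injective _ SetLike.coe_injective
  let _ := Fintype.ofFinite (Submodule S V)
  induction L using WellFoundedLT.induction with
  | ind L ih =>
  -- Each element of `L` generates exactly one submodule of `L`; those generating proper ones are
  -- handled by induction.
  have : (fun x : V => if Submodule.span S {x} = L then (1 : K) else 0) =
      submoduleIndicator K L - ∑ L' ∈ Finset.univ.filter (· < L),
        (fun x : V => if Submodule.span S {x} = L' then (1 : K) else 0) := by
    funext x
    have hx : x ∈ L ↔ Submodule.span S {x} ≤ L := (Submodule.span_singleton_le_iff_mem x L).symm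
    simp only [Pi.sub_apply, Finset.sum_apply, submoduleIndicator, hx, Finset.sum_ite_eq,
      Finset.mem_filter, Finset.mem_univ, true_and, le_iff_lt_or_eq]
    by_cases h1 : Submodule.span S {x} = L
    · simp [h1]
    · by_cases h2 : Submodule.span S {x} < L <;> simp [h1, h2]
  rw [this]
  exact Submodule.sub_mem _ (Submodule.subset_span ⟨L, rfl⟩)
    (Submodule.sum_mem _ fun L' hlt => ih L' (Finset.mem_filter.1 hlt).2)

/-- A function on a finite module that is invariant under the units of the ring is a linear
combination of indicator functions of submodules. -/
theorem invariant_mem_span_submoduleIndicator [Finite S] [Finite V] {f : V → K}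
    (hf : ∀ (u : Sˣ) x, f (u • x) = f x) :
    f ∈ Submodule.span K (Set.range (submoduleIndicator (S := S) (V := V) K)) := by
  classical
  have : Finite (Submodule S V) := Finite.of_injective _ SetLike.coe_injective
  let _ := Fintype.ofFinite (Submodule S V)
  let c : Submodule S V → K := fun L => if h : ∃ x, Submodule.span S {x} = L then f h.choose else 0
  have : f = ∑ L, c L • fun x : V => if Submodule.span S {x} = L then (1 : K) else 0 := by
    funext x
    have hx : ∃ y, Submodule.span S {y} = Submodule.span S {x} := ⟨x, rfl⟩
    obtain ⟨u, hu⟩ := exists_units_smul_eq hx.choose_spec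
    simp only [Finset.sum_apply, Pi.smul_apply, smul_eq_mul, mul_ite, mul_one, mul_zero,
      Finset.sum_ite_eq, Finset.mem_univ, if_true, c, dif_pos hx]
    conv_lhs => rw [← hu, hf]
  rw [this]
  exact Submodule.sum_mem _ fun L _ => Submodule.smul_mem _ _ (generators_indicator_mem_span S K L)

/-- If all submodules of a finite module are cyclic, then their indicator functions are linearly
independent. -/
theorem linearIndependent_submoduleIndicator [Finite V]
    (h : ∀ L : Submodule S V, ∃ x, Submodule.span S {x} = L) :
    LinearIndependent K (submoduleIndicator (S := S) (V := V) K) := by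
  classical
  have : Finite (Submodule S V) := Finite.of_injective _ SetLike.coe_injective
  let _ := Fintype.ofFinite (Submodule S V)
  rw [Fintype.linearIndependent_iff]
  intro c hc L
  -- Descending from the top, evaluation at a generator of `L` sees only submodules containing `L`,
  -- and the coefficients of the larger ones already vanish.
  induction L using WellFoundedGT.induction with
  | ind L ih =>
  obtain ⟨x, rfl⟩ := h L
  have h1 := congrFun hc x
  rw [Finset.sum_apply, Finset.sum_eq_single (Submodule.span S {x})] at h1
  · simpa [submoduleIndicator, Submodule.mem_span_singleton_self] using h1
  · intro L' _ hne
    by_cases hx : x ∈ L'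
    · have : Submodule.span S {x} < L' :=
        lt_of_le_of_ne ((Submodule.span_singleton_le_iff_mem x L').2 hx) (Ne.symm hne)
      rw [Pi.smul_apply, ih L' this, zero_smul]
    · simp [submoduleIndicator, hx]
  · simp

end Indicators

/-! ### Semisimplicity in the form of quasi-inverses. -/

section Regularity

variable {G k V W : Type*} [Group G] [Finite G] [Field k] [CharZero k] [AddCommGroup V] [Module k V]
  [AddCommGroup W] [Module k W] {ρ : Representation k G V} {σ : Representation k G W}

/-- Every map between representations of a finite group in characteristic zero has a
quasi-inverse. -/
theorem exists_quasiInverse (f : ρ.IntertwiningMap σ) :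
    ∃ g : σ.IntertwiningMap ρ, ∀ v, f (g (f v)) = f v := by
  let _ := Fintype.ofFinite G
  obtain ⟨r, hr⟩ := LinearMap.exists_rightInverse_of_surjective f.toLinearMap.rangeRestrict
    (LinearMap.range_rangeRestrict _)
  obtain ⟨g₀, hg₀⟩ := LinearMap.exists_extend r
  have hfg : ∀ v, f (g₀ (f v)) = f v := fun v => by
    have h1 : g₀ (f v) = r (f.toLinearMap.rangeRestrict v) :=
      LinearMap.congr_fun hg₀ (f.toLinearMap.rangeRestrict v)
    have h2 := congrArg Subtype.val (LinearMap.congr_fun hr (f.toLinearMap.rangeRestrict v))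
    rw [h1]
    exact h2
  have hcard : (Fintype.card G : k) ≠ 0 := Nat.cast_ne_zero.2 Fintype.card_ne_zero
  -- The average of a linear quasi-inverse over the group is equivariant. Each conjugate is again a
  -- quasi-inverse because `f` is equivariant, hence so is the average.
  let g : W →ₗ[k] V := (Fintype.card G : k)⁻¹ • ∑ h : G, ρ h ∘ₗ g₀ ∘ₗ σ h⁻¹
  have hg : ∀ w, g w = (Fintype.card G : k)⁻¹ • ∑ h : G, ρ h (g₀ (σ h⁻¹ w)) := fun w => by
    simp [g, LinearMap.sum_apply]
  refine ⟨⟨g, fun a => LinearMap.ext fun w => ?_⟩, fun v => ?_⟩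
  · simp only [LinearMap.comp_apply, hg, map_smul, map_sum]
    congr 1
    refine Fintype.sum_equiv (Equiv.mulLeft a⁻¹) _ _ fun h => ?_
    have h1 : ρ a (ρ (a⁻¹ * h) (g₀ (σ (a⁻¹ * h)⁻¹ w))) = ρ h (g₀ (σ (h⁻¹ * a) w)) := by
      rw [← Module.End.mul_apply, ← map_mul, mul_inv_cancel_left, mul_inv_rev, inv_inv]
    rw [Equiv.coe_mulLeft, h1, map_mul, Module.End.mul_apply]
  · change f (g (f v)) = f v
    rw [hg, map_smul, map_sum]
    have h1 : ∀ h : G, f (ρ h (g₀ (σ h⁻¹ (f v)))) = f v := fun h => by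
      rw [← f.isIntertwining, f.isIntertwining, hfg, f.isIntertwining, ← Module.End.mul_apply,
        ← map_mul, mul_inv_cancel, map_one, Module.End.one_apply]
    simp only [h1, Finset.sum_const, Finset.card_univ]
    rw [← Nat.cast_smul_eq_nsmul k, smul_smul, inv_mul_cancel₀ hcard, one_smul]

end Regularity

/-! ### Linear maps given by matrices. -/

section Kernels

variable {V W U : Type*} [Finite W] [Finite U] (K : Type*) [Field K]

/-- The linear map between spaces with bases `V` and `W` that has the given matrix. -/
noncomputable def kernelMap : (V × W → K) →ₗ[K] ((V →₀ K) →ₗ[K] (W →₀ K)) where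
  toFun f := Finsupp.linearCombination K fun x => Finsupp.equivFunOnFinite.symm fun y => f (x, y)
  map_add' f g := by ext; simp
  map_smul' c f := by ext; simp

@[simp]
theorem kernelMap_single (f : V × W → K) (x : V) (y : W) :
    kernelMap K f (Finsupp.single x 1) y = f (x, y) := by
  simp [kernelMap]

theorem kernelMap_eq_iff {f : V × W → K} {T : (V →₀ K) →ₗ[K] (W →₀ K)} :
    kernelMap K f = T ↔ ∀ x y, T (Finsupp.single x 1) y = f (x, y) := by
  constructor
  · rintro rfl
    simp
  · intro h
    ext x y
    simp [h]

theorem kernelMap_injective : Function.Injective (kernelMap (V := V) (W := W) K) := by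
  intro f g h
  funext ⟨x, y⟩
  rw [← kernelMap_single K f, h, kernelMap_single]

theorem kernelMap_comp [Fintype W] (f : V × W → K) (g : W × U → K) :
    kernelMap K g ∘ₗ kernelMap K f = kernelMap K fun p => ∑ y, f (p.1, y) * g (y, p.2) := by
  symm
  rw [kernelMap_eq_iff]
  intro x z
  have h : kernelMap K f (Finsupp.single x 1) = ∑ y, f (x, y) • Finsupp.single y (1 : K) := by
    classical
    ext y
    simp [Finsupp.finsetSum_apply, Finsupp.single_apply]
  rw [LinearMap.comp_apply, h, map_sum, Finsupp.finsetSum_apply]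
  simp only [map_smul, Finsupp.smul_apply, kernelMap_single, smul_eq_mul]

end Kernels

/-! ### Composition of linear relations. -/

section Relations

variable {S V W U : Type*} [Ring S] [AddCommGroup V] [Module S V] [AddCommGroup W] [Module S W]
  [AddCommGroup U] [Module S U]

/-- The composition of linear relations. -/
def relComp (L : Submodule S (V × W)) (L' : Submodule S (W × U)) : Submodule S (V × U) where
  carrier := {p | ∃ y, (p.1, y) ∈ L ∧ (y, p.2) ∈ L'}
  zero_mem' := ⟨0, L.zero_mem, L'.zero_mem⟩
  add_mem' := by
    rintro p q ⟨y, h1, h2⟩ ⟨z, h3, h4⟩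
    exact ⟨y + z, L.add_mem h1 h3, L'.add_mem h2 h4⟩
  smul_mem' := by
    rintro c p ⟨y, h1, h2⟩
    exact ⟨c • y, L.smul_mem c h1, L'.smul_mem c h2⟩

theorem mem_relComp {L : Submodule S (V × W)} {L' : Submodule S (W × U)} {p : V × U} :
    p ∈ relComp L L' ↔ ∃ y, (p.1, y) ∈ L ∧ (y, p.2) ∈ L' := Iff.rfl

variable [Finite W] [Finite U] (K : Type*) [Field K]

/-- The linear map `u_x ↦ ∑ u_y`, with `y` ranging over the elements related to `x` under the
linear relation `L`. -/
noncomputable def relMap (L : Submodule S (V × W)) : (V →₀ K) →ₗ[K] (W →₀ K) :=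
  kernelMap K (submoduleIndicator K L)

/-- The intermediate elements joining two related elements form a coset of those joining 0 to 0, so
their number does not depend on the pair. -/
theorem relMap_comp (L : Submodule S (V × W)) (L' : Submodule S (W × U)) :
    relMap K L' ∘ₗ relMap K L =
      (Nat.card {y : W // ((0 : V), y) ∈ L ∧ (y, (0 : U)) ∈ L'} : K) • relMap K (relComp L L') := by
  classical
  let _ := Fintype.ofFinite W
  rw [relMap, relMap, relMap, kernelMap_comp, ← map_smul]
  congr 1
  funext p
  simp only [submoduleIndicator, Pi.smul_apply, smul_eq_mul, mul_ite, mul_one, mul_zero, ← ite_and,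
    Finset.sum_boole, mem_relComp]
  split_ifs with h
  · obtain ⟨y₀, h1, h2⟩ := h
    rw [Nat.card_eq_fintype_card, Fintype.card_subtype]
    congr 1
    refine Finset.card_bij' (fun y _ => y - y₀) (fun y _ => y + y₀) ?_ ?_ ?_ ?_
    · intro y hy
      simp only [Finset.mem_filter, Finset.mem_univ, true_and] at hy ⊢
      exact ⟨by simpa using L.sub_mem hy.2 h1, by simpa using L'.sub_mem hy.1 h2⟩
    · intro y hy
      simp only [Finset.mem_filter, Finset.mem_univ, true_and] at hy ⊢
      exact ⟨by simpa using L'.add_mem hy.2 h2, by simpa using L.add_mem hy.1 h1⟩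
    · simp
    · simp
  · rw [Finset.filter_eq_empty_iff.2 fun y _ hy => h ⟨y, hy.2, hy.1⟩, Finset.card_empty,
      Nat.cast_zero]

end Relations

/-! ### Linear functors, their subquotients and stable relations. -/

section Functors

variable {R : Type v} [Ring R] {k : ℕ} {N : Fin k → ModuleCat.{w} R}
  {A : Type u} [CommRing A] [Algebra A R] {F G : FunctorCat.{u, v, w, t} A N}

instance finite_obj (F : FunctorCat.{u, v, w, t} A N) (X : SumCat N) : Finite (F.obj.obj X) :=
  F.property.finite_obj X

theorem map_id_apply {X : SumCat N} (x : F.obj.obj X) : F.obj.map (𝟙 X) x = x := by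
  simp

theorem map_comp_apply {X Y Z : SumCat N} (f : X ⟶ Y) (g : Y ⟶ Z) (x : F.obj.obj X) :
    F.obj.map (f ≫ g) x = F.obj.map g (F.obj.map f x) := by
  simp

theorem map_add_apply {X Y : SumCat N} (f g : X ⟶ Y) (x : F.obj.obj X) :
    F.obj.map (f + g) x = F.obj.map f x + F.obj.map g x := by
  rw [F.property.map_add]
  rfl

theorem map_zero_apply {X Y : SumCat N} (x : F.obj.obj X) :
    F.obj.map (0 : X ⟶ Y) x = 0 := by
  have h := map_add_apply (0 : X ⟶ Y) 0 x
  rwa [add_zero, left_eq_add] at h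

theorem map_sum_apply {X Y : SumCat N} {ι : Type*} (s : Finset ι) (f : ι → (X ⟶ Y))
    (x : F.obj.obj X) : F.obj.map (∑ i ∈ s, f i) x = ∑ i ∈ s, F.obj.map (f i) x := by
  classical
  induction s using Finset.induction_on with
  | empty => simpa using map_zero_apply x
  | insert i s hi ih => rw [Finset.sum_insert hi, Finset.sum_insert hi, map_add_apply, ih]

theorem map_scalarMul_apply {X Y : SumCat N} (r : A) (f : X ⟶ Y) (x : F.obj.obj X) :
    F.obj.map (scalarMul r f) x = r • F.obj.map f x := by
  rw [F.property.map_scalarMul]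
  rfl

theorem app_map_apply (α : F ⟶ G) {X Y : SumCat N} (f : X ⟶ Y) (x : F.obj.obj X) :
    α.hom.app Y (F.obj.map f x) = G.obj.map f (α.hom.app X x) :=
  NatTrans.naturality_apply α.hom f x

/-- The values of a linear functor at `M` form a left module over the endomorphism ring of `M`. -/
instance endModule (F : FunctorCat.{u, v, w, t} A N) (M : SumCat N) :
    Module (End M) (F.obj.obj M) where
  smul r x := F.obj.map r x
  one_smul x := map_id_apply x
  mul_smul r s x := map_comp_apply s r x
  smul_zero r := map_zero (F.obj.map r).hom
  smul_add r := map_add (F.obj.map r).hom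
  add_smul r s x := map_add_apply r s x
  zero_smul x := map_zero_apply x

theorem end_smul_def {M : SumCat N} (r : End M) (x : F.obj.obj M) : r • x = F.obj.map r x := rfl

/-- A natural transformation with bijective components is an isomorphism. -/
noncomputable def isoOfBijective (α : F ⟶ G) (h : ∀ X, Function.Bijective (α.hom.app X)) : F ≅ G :=
  ObjectProperty.isoMk _ (NatIso.ofComponents
    (fun X => (LinearEquiv.ofBijective (α.hom.app X).hom (h X)).toModuleIso)
    (fun f => α.hom.naturality f))

/-- A family of submodules of the values of a functor that is stable under the functor. -/
structure StableFamily (F : FunctorCat.{u, v, w, t} A N) where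
  /-- The submodules. -/
  obj : ∀ X, Submodule A (F.obj.obj X)
  map_mem : ∀ {X Y : SumCat N} (f : X ⟶ Y) {x}, x ∈ obj X → F.obj.map f x ∈ obj Y

namespace StableFamily

/-- A stable family as a functor. -/
noncomputable def sub (P : StableFamily F) : FunctorCat.{u, v, w, t} A N where
  obj :=
    { obj := fun X => ModuleCat.of A (P.obj X)
      map := fun f => ModuleCat.ofHom ((F.obj.map f).hom.restrict fun _ => P.map_mem f)
      map_id := fun X => by
        refine ModuleCat.hom_ext (LinearMap.ext fun x => Subtype.ext ?_)
        exact map_id_apply x.1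
      map_comp := fun f g => by
        refine ModuleCat.hom_ext (LinearMap.ext fun x => Subtype.ext ?_)
        exact map_comp_apply f g x.1 }
  property :=
    { finite_obj := fun X => (inferInstance : Finite (P.obj X))
      map_add := fun f g => by
        refine ModuleCat.hom_ext (LinearMap.ext fun x => Subtype.ext ?_)
        exact map_add_apply f g x.1
      map_scalarMul := fun r f => by
        refine ModuleCat.hom_ext (LinearMap.ext fun x => Subtype.ext ?_)
        exact map_scalarMul_apply r f x.1 }

/-- The inclusion of a subfunctor. -/
noncomputable def incl (P : StableFamily F) : P.sub ⟶ F :=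
  ObjectProperty.homMk
    { app := fun X => ModuleCat.ofHom (P.obj X).subtype
      naturality := fun _ _ _ => rfl }

/-- The quotient of a functor by a stable family. -/
noncomputable def quot (P : StableFamily F) : FunctorCat.{u, v, w, t} A N where
  obj :=
    { obj := fun X => ModuleCat.of A (F.obj.obj X ⧸ P.obj X)
      map := fun f =>
        ModuleCat.ofHom (Submodule.mapQ _ _ (F.obj.map f).hom fun _ => P.map_mem f)
      map_id := fun X => by
        ext x
        exact congrArg (Submodule.mkQ _) (map_id_apply x)
      map_comp := fun f g => by
        ext x
        exact congrArg (Submodule.mkQ _) (map_comp_apply f g x) }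
  property :=
    { finite_obj := fun X => Finite.of_surjective _ (Submodule.mkQ_surjective (P.obj X))
      map_add := fun f g => by
        ext x
        exact congrArg (Submodule.mkQ _) (map_add_apply f g x)
      map_scalarMul := fun r f => by
        ext x
        exact congrArg (Submodule.mkQ _) (map_scalarMul_apply r f x) }

/-- The projection onto a quotient functor. -/
noncomputable def proj (P : StableFamily F) : F ⟶ P.quot :=
  ObjectProperty.homMk
    { app := fun X => ModuleCat.ofHom (P.obj X).mkQ
      naturality := fun _ _ _ => rfl }

theorem incl_injective (P : StableFamily F) (X : SumCat N) :
    Function.Injective (P.incl.hom.app X) := Subtype.val_injective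

theorem proj_surjective (P : StableFamily F) (X : SumCat N) :
    Function.Surjective (P.proj.hom.app X) := Submodule.mkQ_surjective _

end StableFamily

/-- If a subquotient has, at `X`, as many elements as the functor, then the two maps that
realise it as a subquotient are bijective at `X`. -/
theorem bijective_of_card_le {H : FunctorCat.{u, v, w, t} A N} {i : H ⟶ F} {p : H ⟶ G}
    {X : SumCat N} (hi : Function.Injective (i.hom.app X)) (hp : Function.Surjective (p.hom.app X))
    (h : Nat.card (F.obj.obj X) ≤ Nat.card (G.obj.obj X)) :
    Function.Bijective (i.hom.app X) ∧ Function.Bijective (p.hom.app X) := by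
  have h1 := Nat.card_le_card_of_injective _ hi
  have h2 := Nat.card_le_card_of_surjective _ hp
  exact ⟨hi.bijective_of_nat_card_le (h.trans h2), hp.bijective_of_nat_card_le (h1.trans h)⟩

/-- A stable family of linear relations between two functors. -/
structure StableRelation (F G : FunctorCat.{u, v, w, t} A N) where
  /-- The relations. -/
  obj : ∀ X, Submodule A (F.obj.obj X × G.obj.obj X)
  map_mem : ∀ {X Y : SumCat N} (f : X ⟶ Y) {x y}, (x, y) ∈ obj X →
    (F.obj.map f x, G.obj.map f y) ∈ obj Y

namespace StableRelation

/-- A relation at `M` that is linear over the endomorphism ring of `M` extends to a stable family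
of relations. -/
noncomputable def extend {M : SumCat N} (L : Submodule (End M) (F.obj.obj M × G.obj.obj M)) :
    StableRelation F G where
  obj X :=
    { carrier := {p | ∀ f : X ⟶ M, (F.obj.map f p.1, G.obj.map f p.2) ∈ L}
      zero_mem' := fun f => by
        have h : ((F.obj.map f).hom 0, (G.obj.map f).hom 0) ∈ L := by
          rw [map_zero, map_zero]
          exact L.zero_mem
        exact h
      add_mem' := fun {p q} hp hq f => by
        have h : ((F.obj.map f).hom (p.1 + q.1), (G.obj.map f).hom (p.2 + q.2)) ∈ L := by
          rw [map_add, map_add]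
          exact L.add_mem (hp f) (hq f)
        exact h
      smul_mem' := fun c p hp f => by
        -- `L` is only assumed linear over `End(M)`; stability under scalars comes from testing
        -- against `c • f`, by linearity of the functors.
        have h := hp (scalarMul c f)
        rw [map_scalarMul_apply, map_scalarMul_apply] at h
        have h' : ((F.obj.map f).hom (c • p.1), (G.obj.map f).hom (c • p.2)) ∈ L := by
          rw [map_smul, map_smul]
          exact h
        exact h' }
  map_mem := by
    intro X Y f x y h g
    have := h (f ≫ g)
    rwa [map_comp_apply, map_comp_apply] at this

theorem mem_extend {M X : SumCat N} {L : Submodule (End M) (F.obj.obj M × G.obj.obj M)}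
    {x : F.obj.obj X} {y : G.obj.obj X} : (x, y) ∈ (extend L).obj X ↔
      ∀ f : X ⟶ M, (F.obj.map f x, G.obj.map f y) ∈ L := Iff.rfl

theorem mem_extend_self {M : SumCat N} {L : Submodule (End M) (F.obj.obj M × G.obj.obj M)}
    {x : F.obj.obj M} {y : G.obj.obj M} : (x, y) ∈ (extend L).obj M ↔ (x, y) ∈ L := by
  refine ⟨fun h => ?_, fun h f => L.smul_mem (f : End M) h⟩
  have := mem_extend.1 h (𝟙 M)
  rwa [map_id_apply, map_id_apply] at this

/-- The elements of `G` that are related to some element of `F`. -/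
noncomputable def codomain (H : StableRelation F G) : StableFamily G where
  obj X := (H.obj X).map (LinearMap.snd A _ _)
  map_mem := by
    intro X Y f y h
    obtain ⟨⟨x, y⟩, h, rfl⟩ := h
    exact ⟨(F.obj.map f x, G.obj.map f y), H.map_mem f h, rfl⟩

theorem mem_codomain {H : StableRelation F G} {X : SumCat N} {y : G.obj.obj X} :
    y ∈ H.codomain.obj X ↔ ∃ x, (x, y) ∈ H.obj X := by
  constructor
  · rintro ⟨⟨x, y⟩, h, rfl⟩
    exact ⟨x, h⟩
  · rintro ⟨x, h⟩
    exact ⟨(x, y), h, rfl⟩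

/-- The elements of the codomain that are related to zero. -/
noncomputable def indeterminacy (H : StableRelation F G) : StableFamily H.codomain.sub where
  obj X := ((H.obj X).comap (LinearMap.inr A _ _)).comap (H.codomain.obj X).subtype
  map_mem := by
    intro X Y f y h
    have h1 : ((0 : F.obj.obj X), y.1) ∈ H.obj X := h
    have h2 := H.map_mem f h1
    have h3 : F.obj.map f (0 : F.obj.obj X) = 0 := map_zero (F.obj.map f).hom
    rw [h3] at h2
    exact h2

/-- The codomain modulo the indeterminacy. -/
noncomputable def core (H : StableRelation F G) : FunctorCat.{u, v, w, t} A N :=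
  H.indeterminacy.quot

theorem isSubquotient_core (H : StableRelation F G) : IsSubquotient H.core G :=
  ⟨H.codomain.sub, H.codomain.incl, H.indeterminacy.proj, H.codomain.incl_injective,
    H.indeterminacy.proj_surjective⟩

/-- A stable family of relations that are everywhere surjective and single-valued is the graph of
an automorphism. -/
theorem exists_aut (H : StableRelation F F) (h1 : ∀ X y, ∃ x, (x, y) ∈ H.obj X)
    (h2 : ∀ X y, ((0 : F.obj.obj X), y) ∈ H.obj X → y = 0) :
    ∃ α : Aut F, ∀ X x y, (x, y) ∈ H.obj X ↔ α.hom.hom.app X x = y := by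
  choose s hs using h1
  have huniq : ∀ X x y y', (x, y) ∈ H.obj X → (x, y') ∈ H.obj X → y = y' := by
    intro X x y y' h h'
    refine sub_eq_zero.1 (h2 X _ ?_)
    have := (H.obj X).sub_mem h h'
    rwa [Prod.mk_sub_mk, sub_self] at this
  -- Single-valuedness makes a choice of preimages injective, and finiteness makes it bijective, so
  -- every element is related to something.
  have hinj : ∀ X, Function.Injective (s X) := fun X y y' h =>
    huniq X (s X y) y y' (hs X y) (h ▸ hs X y')
  have hbij : ∀ X, Function.Bijective (s X) := fun X => Finite.injective_iff_bijective.1 (hinj X)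
  have htot : ∀ X x, ∃ y, (x, y) ∈ H.obj X := fun X x => by
    obtain ⟨y, rfl⟩ := (hbij X).2 x
    exact ⟨y, hs X y⟩
  choose a ha using htot
  have haa : ∀ X x y, (x, y) ∈ H.obj X ↔ a X x = y := fun X x y =>
    ⟨fun h => huniq X x _ _ (ha X x) h, fun h => h ▸ ha X x⟩
  have hsurj : ∀ X, Function.Surjective (a X) := fun X y => ⟨s X y, (haa X _ _).1 (hs X y)⟩
  let α : F ⟶ F := ObjectProperty.homMk
    { app := fun X => ModuleCat.ofHom
        { toFun := a X
          map_add' := fun x y => (haa X _ _).1 ((H.obj X).add_mem (ha X x) (ha X y))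
          map_smul' := fun c x => (haa X _ _).1 ((H.obj X).smul_mem c (ha X x)) }
      naturality := fun X Y f => by
        ext x
        exact (haa Y _ _).1 (H.map_mem f (ha X x)) }
  exact ⟨isoOfBijective α fun X => Finite.surjective_iff_bijective.1 (hsurj X), haa⟩

/-- If the core of a relation on `F` is isomorphic to `F`, then the relation is the graph of an
automorphism. -/
theorem exists_aut_of_iso (H : StableRelation F F) (e : H.core ≅ F) :
    ∃ α : Aut F, ∀ X x y, (x, y) ∈ H.obj X ↔ α.hom.hom.app X x = y := by
  have hcard : ∀ X, Nat.card (F.obj.obj X) ≤ Nat.card (H.core.obj.obj X) := fun X => by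
    refine Nat.card_le_card_of_injective (e.inv.hom.app X) ?_
    refine Function.LeftInverse.injective (g := e.hom.hom.app X) fun x => ?_
    have := congrArg (fun β : F ⟶ F => β.hom.app X x) e.inv_hom_id
    exact this
  have hb := fun X => bijective_of_card_le (H.codomain.incl_injective X)
    (H.indeterminacy.proj_surjective X) (hcard X)
  refine H.exists_aut (fun X y => ?_) (fun X y hy => ?_)
  · obtain ⟨z, rfl⟩ := (hb X).1.2 y
    exact mem_codomain.1 z.2
  · have hz : y ∈ H.codomain.obj X := mem_codomain.2 ⟨0, hy⟩
    have h0 : (⟨y, hz⟩ : H.codomain.sub.obj.obj X) ∈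
        LinearMap.ker (H.indeterminacy.obj X).mkQ := by
      rw [Submodule.ker_mkQ]
      exact hy
    have hinj : Function.Injective (H.indeterminacy.obj X).mkQ := (hb X).2.1
    rw [LinearMap.ker_eq_bot.2 hinj] at h0
    have h1 : (⟨y, hz⟩ : H.codomain.sub.obj.obj X) = 0 := h0
    exact congrArg Subtype.val h1

end StableRelation

end Functors

/-! ### The largest subrepresentation and surjectivity. -/

section Surjectivity

variable {R : Type v} [Ring R] {k : ℕ} {N : Fin k → ModuleCat.{w} R}
  {A : Type u} [CommRing A] [Algebra A R] {F G : FunctorCat.{u, v, w, t} A N} {M : SumCat N}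

/-- A component of a natural transformation, as a linear map over the endomorphism ring. -/
noncomputable def appEnd (α : F ⟶ G) (M : SumCat N) : F.obj.obj M →ₗ[End M] G.obj.obj M where
  toFun := α.hom.app M
  map_add' := map_add (α.hom.app M).hom
  map_smul' r x := app_map_apply α r x

variable {K : Type s} [Field K]

theorem permRep_apply_map (g : Aut M) (f : F.obj.obj M →₀ K) (x : F.obj.obj M) :
    permRep K F M g f (F.obj.map g.hom x) = f x := by
  refine Finsupp.mapDomain_apply (Function.LeftInverse.injective (g := F.obj.map g.inv) ?_) f x
  intro y
  rw [← map_comp_apply, g.hom_inv_id, map_id_apply]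

theorem permRep_single (g : Aut M) (x : F.obj.obj M) :
    permRep K F M g (Finsupp.single x 1) = Finsupp.single (F.obj.map g.hom x) 1 :=
  Finsupp.mapDomain_single

variable (K) in
/-- The map of representations defined by a linear relation. -/
noncomputable def relIntertwining (L : Submodule (End M) (F.obj.obj M × G.obj.obj M)) :
    (permRep K F M).IntertwiningMap (permRep K G M) where
  toLinearMap := relMap K L
  isIntertwining' g := by
    refine Finsupp.lhom_ext' fun x => LinearMap.ext_ring (Finsupp.ext fun y => ?_)
    obtain ⟨z, rfl⟩ : ∃ z, G.obj.map g.hom z = y :=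
      ⟨G.obj.map g.inv y, by rw [← map_comp_apply, g.inv_hom_id, map_id_apply]⟩
    simp only [LinearMap.comp_apply, Finsupp.lsingle_apply, permRep_single, permRep_apply_map,
      relMap, kernelMap_single, submoduleIndicator]
    have h : (F.obj.map g.hom x, G.obj.map g.hom z) ∈ L ↔ (x, z) ∈ L := by
      refine ⟨fun h => ?_, fun h => L.smul_mem (g.hom : End M) h⟩
      have h' := L.smul_mem (g.inv : End M) h
      rwa [Prod.smul_mk, end_smul_def, end_smul_def, ← map_comp_apply, ← map_comp_apply,
        g.hom_inv_id, map_id_apply, map_id_apply] at h'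
    by_cases hxz : (x, z) ∈ L
    · rw [if_pos (h.2 hxz), if_pos hxz]
    · rw [if_neg (mt h.1 hxz), if_neg hxz]

/-- Maps between the permutation representations are spanned by those defined by linear
relations. -/
theorem intertwiningMap_mem_span [Finite (End M)]
    (T : (permRep K F M).IntertwiningMap (permRep K G M)) :
    T.toLinearMap ∈ Submodule.span K
      (Set.range (relMap (S := End M) (V := F.obj.obj M) (W := G.obj.obj M) K)) := by
  let f : F.obj.obj M × G.obj.obj M → K := fun p => T (Finsupp.single p.1 1) p.2
  have hf : f ∈ Submodule.span K (Set.range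
      (submoduleIndicator (S := End M) (V := F.obj.obj M × G.obj.obj M) K)) := by
    refine invariant_mem_span_submoduleIndicator (End M) K fun u p => ?_
    let g : Aut M := Aut.unitsEndEquivAut M u
    change T (Finsupp.single (F.obj.map g.hom p.1) 1) (G.obj.map g.hom p.2) = _
    rw [← permRep_single, T.isIntertwining, permRep_apply_map]
  have hT : kernelMap K f = T.toLinearMap := (kernelMap_eq_iff K).2 fun x y => rfl
  have h := Submodule.mem_map_of_mem (f := kernelMap K) hf
  rwa [hT, Submodule.map_span, ← Set.range_comp] at h

/-- The inclusion of a subrepresentation. -/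
def subtypeMap {Γ V : Type*} [Group Γ] [AddCommMonoid V] [Module K V] {ρ : Representation K Γ V}
    (W : Subrepresentation ρ) : W.toRepresentation.IntertwiningMap ρ where
  toLinearMap := W.toSubmodule.subtype
  isIntertwining' _ := rfl

/-- The graph of a natural transformation defines the map induced by it. -/
theorem relMap_eq_pushforward {L : Submodule (End M) (F.obj.obj M × G.obj.obj M)} {α : F ⟶ G}
    (h : ∀ x y, (x, y) ∈ L ↔ α.hom.app M x = y) :
    relMap K L = (pushforward K α M).toLinearMap := by
  classical
  refine (kernelMap_eq_iff K).2 fun x y => ?_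
  change Finsupp.mapDomain _ (Finsupp.single x 1) y = _
  rw [Finsupp.mapDomain_single, Finsupp.single_apply, submoduleIndicator]
  simp only [h]

theorem Phi_single_apply (α : Aut F) (c : K) (x : (barRep K F M).toSubmodule) :
    (Phi K F M (MonoidAlgebra.single α c) x).1 = c • pushforward K α.hom M x.1 := by
  rw [Phi, MonoidAlgebra.lift_single]
  rfl

theorem le_barRep {W : Subrepresentation (permRep K F M)} (hW : NoMapsFromBelow W) :
    W.toSubmodule ≤ (barRep K F M).toSubmodule :=
  le_iSup (fun W : {W : Subrepresentation (permRep K F M) // NoMapsFromBelow W} =>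
    W.1.toSubmodule) ⟨W, hW⟩

variable [CharZero K] [Finite (Aut M)]

/-- In characteristic zero every subrepresentation is a direct summand. -/
theorem exists_projection {Γ V : Type*} [Group Γ] [Finite Γ] [AddCommGroup V] [Module K V]
    {ρ : Representation K Γ V} (W : Subrepresentation ρ) :
    ∃ p : ρ.IntertwiningMap W.toRepresentation, ∀ x : W.toSubmodule, p x.1 = x := by
  obtain ⟨p, hp⟩ := exists_quasiInverse (subtypeMap W)
  exact ⟨p, fun x => Subtype.ext (hp x)⟩

/-- Quasi-inverses exchange maps into and out of `W`. The second form is inherited by sums of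
subrepresentations, since it places `W` inside kernels. -/
theorem noMapsFromBelow_iff (W : Subrepresentation (permRep K F M)) :
    NoMapsFromBelow W ↔ ∀ G : FunctorCat.{u, v, w, t} A N, StrictlyBelow G F →
      ∀ ψ : (permRep K F M).IntertwiningMap (permRep K G M), ∀ x ∈ W.toSubmodule, ψ x = 0 := by
  constructor
  · intro hW G hG ψ x hx
    obtain ⟨φ, hφ⟩ := exists_quasiInverse (V := W.toSubmodule)
      (ρ := W.toRepresentation) (ψ.comp (subtypeMap W))
    have h := hφ ⟨x, hx⟩
    rw [hW G hG φ, Representation.IntertwiningMap.coe_zero, Pi.zero_apply, map_zero] at h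
    exact h.symm
  · intro hW G hG φ
    obtain ⟨ψ, hψ⟩ := exists_quasiInverse (W := W.toSubmodule) φ
    obtain ⟨p, hp⟩ := exists_projection W
    refine Representation.IntertwiningMap.ext (LinearMap.ext fun z => ?_)
    have h := hW G hG (ψ.comp p) (φ z).1 (φ z).2
    rw [Representation.IntertwiningMap.comp_apply, hp] at h
    have h' := hψ z
    rw [h, map_zero] at h'
    exact h'.symm

theorem eq_zero_of_mem_barRep (hG : StrictlyBelow G F)
    (ψ : (permRep K F M).IntertwiningMap (permRep K G M)) {x : F.obj.obj M →₀ K}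
    (hx : x ∈ (barRep K F M).toSubmodule) : ψ x = 0 := by
  have h : (barRep K F M).toSubmodule ≤ LinearMap.ker ψ.toLinearMap :=
    iSup_le fun W y hy => (noMapsFromBelow_iff W.1).1 W.2 G hG ψ y hy
  exact h hx

theorem isGreatest_barRep :
    IsGreatest {W : Subrepresentation (permRep K F M) | NoMapsFromBelow W} (barRep K F M) :=
  ⟨(noMapsFromBelow_iff _).2 fun _ hG ψ _ hx => eq_zero_of_mem_barRep hG ψ hx,
    fun _ hW => le_barRep hW⟩

/-- A linear relation that is not the graph of an automorphism factors through the representation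
of a smaller functor, and therefore defines the zero map on `\overline{K F(M)}`. -/
theorem relMap_eq_zero (L : Submodule (End M) (F.obj.obj M × F.obj.obj M))
    (hL : ¬ Nonempty ((StableRelation.extend L).core ≅ F)) {x : F.obj.obj M →₀ K}
    (hx : x ∈ (barRep K F M).toSubmodule) : relMap K L x = 0 := by
  let H := StableRelation.extend L
  let i := appEnd H.codomain.incl M
  let p : H.codomain.sub.obj.obj M →ₗ[End M] H.core.obj.obj M := appEnd H.indeterminacy.proj M
  -- `L₁` relates `a` to the class of `y` whenever `(a, y) ∈ L`, and `L₂` relates a class to each of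
  -- its representatives. Their composite is `L` because elements of the indeterminacy are related
  -- to 0.
  let L₁ : Submodule (End M) (F.obj.obj M × H.core.obj.obj M) :=
    (L.comap (LinearMap.id.prodMap i)).map (LinearMap.id.prodMap p)
  let L₂ : Submodule (End M) (H.core.obj.obj M × F.obj.obj M) := LinearMap.range (p.prod i)
  have hp : ∀ y, p y = 0 → ((0 : F.obj.obj M), i y) ∈ L := fun y hy => by
    rw [← StableRelation.mem_extend_self]
    exact (Submodule.Quotient.mk_eq_zero (H.indeterminacy.obj M)).1 hy
  have hcomp : relComp L₁ L₂ = L := by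
    ext ⟨a, b⟩
    rw [mem_relComp]
    constructor
    · rintro ⟨q, ⟨⟨a', y⟩, h1, h2⟩, ⟨y', h3⟩⟩
      obtain ⟨rfl, rfl⟩ := Prod.ext_iff.1 h2
      obtain ⟨h4, rfl⟩ := Prod.ext_iff.1 h3
      have h5 : p (y' - y) = 0 := by
        rw [map_sub, sub_eq_zero]
        exact h4
      have h6 := L.add_mem h1 (hp _ h5)
      simpa using h6
    · intro hab
      have hb : b ∈ H.codomain.obj M :=
        StableRelation.mem_codomain.2 ⟨a, StableRelation.mem_extend_self.2 hab⟩
      exact ⟨p ⟨b, hb⟩, ⟨(a, ⟨b, hb⟩), hab, rfl⟩, ⟨⟨b, hb⟩, rfl⟩⟩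
  have h := LinearMap.congr_fun (relMap_comp K L₁ L₂) x
  have hbelow : StrictlyBelow H.core F := ⟨H.isSubquotient_core, hL⟩
  have h0 : relMap K L₁ x = 0 := eq_zero_of_mem_barRep hbelow (relIntertwining K L₁) hx
  rw [hcomp, LinearMap.comp_apply, h0, map_zero, LinearMap.smul_apply, eq_comm,
    smul_eq_zero] at h
  -- The scalar counts a set containing 0, hence is nonzero in characteristic zero.
  refine h.resolve_left (Nat.cast_ne_zero.2 ?_)
  have : Nonempty {y : H.core.obj.obj M // ((0 : F.obj.obj M), y) ∈ L₁ ∧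
      (y, (0 : F.obj.obj M)) ∈ L₂} := ⟨⟨0, L₁.zero_mem, L₂.zero_mem⟩⟩
  exact Nat.card_pos.ne'

/-- An endomorphism of the largest subrepresentation extends to `K F(M)` through a projection. The
extension is a combination of relations, whose restrictions are either induced by automorphisms or
zero. -/
theorem Phi_surjective [Finite (End M)] : Function.Surjective (Phi K F M) := by
  intro e
  obtain ⟨p, hp⟩ := exists_projection (barRep K F M)
  let T := (subtypeMap (barRep K F M)).comp (e.comp p)
  have key : ∀ T' ∈ Submodule.span K
      (Set.range (relMap (S := End M) (V := F.obj.obj M) (W := F.obj.obj M) K)),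
      ∃ z, ∀ x : (barRep K F M).toSubmodule, T' x.1 = (Phi K F M z x).1 := by
    intro T' hT'
    induction hT' using Submodule.span_induction with
    | mem T' h =>
      obtain ⟨L, rfl⟩ := h
      by_cases hL : Nonempty ((StableRelation.extend L).core ≅ F)
      · obtain ⟨α, hα⟩ := StableRelation.exists_aut_of_iso _ hL.some
        refine ⟨MonoidAlgebra.single α 1, fun x => ?_⟩
        rw [Phi_single_apply, one_smul, relMap_eq_pushforward (α := α.hom) fun x y => by
          rw [← hα M x y, StableRelation.mem_extend_self]]
        rfl
      · refine ⟨0, fun x => ?_⟩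
        rw [relMap_eq_zero L hL x.2, map_zero]
        rfl
    | zero => exact ⟨0, fun x => by rw [map_zero]; rfl⟩
    | add T₁ T₂ _ _ h₁ h₂ =>
      obtain ⟨z₁, h₁⟩ := h₁
      obtain ⟨z₂, h₂⟩ := h₂
      exact ⟨z₁ + z₂, fun x => by rw [map_add, LinearMap.add_apply, h₁, h₂]; rfl⟩
    | smul c T₁ _ h₁ =>
      obtain ⟨z₁, h₁⟩ := h₁
      exact ⟨c • z₁, fun x => by rw [map_smul, LinearMap.smul_apply, h₁]; rfl⟩
  obtain ⟨z, hz⟩ := key _ (intertwiningMap_mem_span T)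
  refine ⟨z, Representation.IntertwiningMap.ext (LinearMap.ext fun x => Subtype.ext ?_)⟩
  refine (hz x).symm.trans ?_
  change (e (p x.1)).1 = (e x).1
  rw [hp]

end Surjectivity

/-! ### Matrix units between direct sums. -/

section Transfer

variable {R : Type v} [Ring R] {k : ℕ} {N : Fin k → ModuleCat.{w} R} {X Y Z : SumCat N}
  {a b c : Fin k → ℕ}

/-- The morphism from `X` to `Y` that maps the `j`-th copy of `N i` in `X` identically to the
`j'`-th copy of `N i` in `Y`, and all other summands to zero. -/
noncomputable def transfer (e : X.obj ≃ₗ[R] ((i : Fin k) → Fin (a i) → N i))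
    (e' : Y.obj ≃ₗ[R] ((i : Fin k) → Fin (b i) → N i)) (i : Fin k) (j : Fin (a i))
    (j' : Fin (b i)) : X ⟶ Y :=
  ObjectProperty.homMk (ModuleCat.ofHom
    (e'.symm.toLinearMap ∘ₗ LinearMap.single R (fun i => Fin (b i) → N i) i ∘ₗ
      LinearMap.single R (fun _ => N i) j' ∘ₗ LinearMap.proj j ∘ₗ LinearMap.proj i ∘ₗ
        e.toLinearMap))

variable (e : X.obj ≃ₗ[R] ((i : Fin k) → Fin (a i) → N i))
  (e' : Y.obj ≃ₗ[R] ((i : Fin k) → Fin (b i) → N i))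
  (e'' : Z.obj ≃ₗ[R] ((i : Fin k) → Fin (c i) → N i))

theorem transfer_apply (i : Fin k) (j : Fin (a i)) (j' : Fin (b i)) (x : X.obj) :
    (transfer e e' i j j').hom.hom x = e'.symm (Pi.single i (Pi.single j' (e x i j))) := rfl

theorem hom_ext_apply {f g : X ⟶ Y} (h : ∀ x, f.hom.hom x = g.hom.hom x) : f = g :=
  ObjectProperty.hom_ext _ (ModuleCat.hom_ext (LinearMap.ext h))

theorem transfer_comp (i : Fin k) (j : Fin (a i)) (j' : Fin (b i)) (j'' : Fin (c i)) :
    transfer e e' i j j' ≫ transfer e' e'' i j' j'' = transfer e e'' i j j'' := by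
  refine hom_ext_apply fun x => ?_
  change (transfer e' e'' i j' j'').hom.hom ((transfer e e' i j j').hom.hom x) = _
  simp only [transfer_apply, LinearEquiv.apply_symm_apply, Pi.single_eq_same]

theorem transfer_comp_of_ne {i i₂ : Fin k} (j : Fin (a i)) {j' : Fin (b i)} {j₂ : Fin (b i₂)}
    (j₃ : Fin (c i₂)) (h : (⟨i, j'⟩ : Σ i, Fin (b i)) ≠ ⟨i₂, j₂⟩) :
    transfer e e' i j j' ≫ transfer e' e'' i₂ j₂ j₃ = 0 := by
  refine hom_ext_apply fun x => ?_
  change (transfer e' e'' i₂ j₂ j₃).hom.hom ((transfer e e' i j j').hom.hom x) = 0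
  simp only [transfer_apply, LinearEquiv.apply_symm_apply]
  by_cases hi : i = i₂
  · subst hi
    have hj : j₂ ≠ j' := fun hj => h (by rw [hj])
    simp [hj]
  · simp [Pi.single_eq_of_ne (Ne.symm hi)]

theorem sum_transfer : ∑ i, ∑ j, transfer e e i j j = 𝟙 X := by
  refine hom_ext_apply fun x => ?_
  let ev : (X ⟶ X) →+ X.obj :=
    { toFun := fun f => f.hom.hom x
      map_zero' := rfl
      map_add' := fun _ _ => rfl }
  change ev (∑ i, ∑ j, transfer e e i j j) = x
  simp only [map_sum]
  change ∑ i, ∑ j, e.symm (Pi.single i (Pi.single j (e x i j))) = x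
  simp only [← map_sum]
  rw [LinearEquiv.symm_apply_eq]
  funext i j
  rw [Finset.sum_apply, Finset.sum_apply, Finset.sum_eq_single i, Finset.sum_apply,
    Finset.sum_apply, Finset.sum_eq_single j]
  · simp
  · intro j' _ hj
    simp [hj.symm]
  · simp
  · intro i' _ hi
    rw [Finset.sum_apply, Finset.sum_apply]
    refine Finset.sum_eq_zero fun j' _ => ?_
    rw [Pi.single_eq_of_ne hi.symm, Pi.zero_apply]
  · simp

end Transfer

/-! ### Objects with positive or large multiplicities. -/

section Large

variable {R : Type v} [Ring R] {k : ℕ} {N : Fin k → ModuleCat.{w} R}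
  {A : Type u} [CommRing A] [Algebra A R] {F G : FunctorCat.{u, v, w, t} A N} {M : SumCat N}
  {a : Fin k → ℕ}

/-- If all multiplicities of `M` are positive, then the identity of every object is a sum of
morphisms that factor through `M`. -/
theorem exists_sum_comp_eq_id (hM : HasMultiplicities N M.obj a) (ha : ∀ i, 0 < a i)
    (X : SumCat N) : ∃ (ι : Type) (_ : Fintype ι) (f : ι → (X ⟶ M)) (g : ι → (M ⟶ X)),
      ∑ i, f i ≫ g i = 𝟙 X := by
  obtain ⟨e⟩ := hM
  obtain ⟨b, ⟨e'⟩⟩ := X.property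
  refine ⟨Σ i, Fin (b i), inferInstance, fun p => transfer e' e p.1 p.2 ⟨0, ha p.1⟩,
    fun p => transfer e e' p.1 ⟨0, ha p.1⟩ p.2, ?_⟩
  simp only [transfer_comp]
  rw [Fintype.sum_sigma]
  exact sum_transfer e'

/-- An element of `F(X)` is determined by its images in `F(M)`, since the identity of `X` is a sum
of morphisms factoring through `M`. -/
theorem app_injective (hM : HasMultiplicities N M.obj a) (ha : ∀ i, 0 < a i) {α : F ⟶ G}
    (h : Function.Injective (α.hom.app M)) (X : SumCat N) :
    Function.Injective (α.hom.app X) := by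
  obtain ⟨ι, _, f, g, hfg⟩ := exists_sum_comp_eq_id hM ha X
  intro x y hxy
  rw [← map_id_apply x, ← map_id_apply y, ← hfg, map_sum_apply, map_sum_apply]
  refine Finset.sum_congr rfl fun i _ => ?_
  rw [map_comp_apply, map_comp_apply]
  congr 1
  refine h ?_
  rw [app_map_apply, app_map_apply, hxy]

theorem app_surjective (hM : HasMultiplicities N M.obj a) (ha : ∀ i, 0 < a i) {α : F ⟶ G}
    (h : Function.Surjective (α.hom.app M)) (X : SumCat N) :
    Function.Surjective (α.hom.app X) := by
  obtain ⟨ι, _, f, g, hfg⟩ := exists_sum_comp_eq_id hM ha X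
  intro y
  choose z hz using fun i => h (G.obj.map (f i) y)
  refine ⟨∑ i, F.obj.map (g i) (z i), ?_⟩
  have h1 : α.hom.app X (∑ i, F.obj.map (g i) (z i)) = ∑ i, α.hom.app X (F.obj.map (g i) (z i)) :=
    map_sum (α.hom.app X).hom _ _
  rw [h1]
  conv_rhs => rw [← map_id_apply y, ← hfg, map_sum_apply]
  refine Finset.sum_congr rfl fun i _ => ?_
  rw [app_map_apply, hz, map_comp_apply]

theorem hom_ext_of_app_eq (hM : HasMultiplicities N M.obj a) (ha : ∀ i, 0 < a i) {α β : F ⟶ G}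
    (h : ∀ x, α.hom.app M x = β.hom.app M x) : α = β := by
  refine ObjectProperty.hom_ext _ (NatTrans.ext (funext fun X => ModuleCat.hom_ext
    (LinearMap.ext fun x => ?_)))
  obtain ⟨ι, _, f, g, hfg⟩ := exists_sum_comp_eq_id hM ha X
  change α.hom.app X x = β.hom.app X x
  rw [← map_id_apply (α.hom.app X x), ← map_id_apply (β.hom.app X x), ← hfg, map_sum_apply,
    map_sum_apply]
  refine Finset.sum_congr rfl fun i _ => ?_
  rw [map_comp_apply, map_comp_apply, ← app_map_apply α (f i), ← app_map_apply β (f i), h]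

variable (N) in
/-- The direct sum of the modules `N i`. -/
noncomputable def sumObj : SumCat N where
  obj := ModuleCat.of R ((i : Fin k) → Fin 1 → N i)
  property := ⟨fun _ => 1, ⟨LinearEquiv.refl R _⟩⟩

/-- If the multiplicities of `M` are large, then all submodules of `F(M) × G(M)` are cyclic. -/
theorem exists_span_singleton_eq (hM : HasMultiplicities N M.obj a)
    (ha : ∀ i, Nat.card (F.obj.obj (sumObj N) × G.obj.obj (sumObj N)) ≤ a i)
    (L : Submodule (End M) (F.obj.obj M × G.obj.obj M)) :
    ∃ x, Submodule.span (End M) {x} = L := by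
  classical
  obtain ⟨e⟩ := hM
  have hpos : ∀ i, 0 < a i := fun i => lt_of_lt_of_le Nat.card_pos (ha i)
  let o : ∀ i, Fin (a i) := fun i => ⟨0, hpos i⟩
  let T : ∀ i, Fin (a i) → Fin (a i) → End M := fun i j j' => transfer e e i j j'
  have hT : ∀ i j j' j'' (x : F.obj.obj M × G.obj.obj M),
      T i j' j'' • T i j j' • x = T i j j'' • x := fun i j j' j'' x => by
    rw [← mul_smul]
    exact congrArg (· • x) (transfer_comp e e e i j j' j'')
  have hT0 : ∀ i i₂ (j j' : Fin (a i)) (j₂ j₃ : Fin (a i₂)) (x : F.obj.obj M × G.obj.obj M),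
      (⟨i, j'⟩ : Σ i, Fin (a i)) ≠ ⟨i₂, j₂⟩ → T i₂ j₂ j₃ • T i j j' • x = 0 :=
    fun i i₂ j j' j₂ j₃ x h => by
      rw [← mul_smul]
      refine Eq.trans ?_ (zero_smul (End M) x)
      exact congrArg (· • x) (transfer_comp_of_ne e e e j j₃ h)
  have hsum : ∀ x : F.obj.obj M × G.obj.obj M, ∑ i, ∑ j, T i j j • x = x := fun x => by
    simp only [← Finset.sum_smul]
    refine Eq.trans ?_ (one_smul (End M) x)
    exact congrArg (· • x) (sum_transfer e)
  -- the part of `L` that comes from the first copy of `N i` embeds into the set of all copies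
  let B : Fin k → Type _ := fun i =>
    {x : F.obj.obj M × G.obj.obj M // x ∈ L ∧ T i (o i) (o i) • x = x}
  let _ : ∀ i, Fintype (B i) := fun i => Fintype.ofFinite _
  have hn : ∀ i, Nonempty (B i ↪ Fin (a i)) := fun i => by
    refine Function.Embedding.nonempty_of_card_le ?_
    rw [Fintype.card_fin, ← Nat.card_eq_fintype_card]
    refine le_trans ?_ (ha i)
    -- The projection to the first copy of `N i` factors through `sumObj N`, which bounds the size
    -- of `B i` independently of `M`.
    let e₀ : (sumObj N).obj ≃ₗ[R] ((i : Fin k) → Fin 1 → N i) := LinearEquiv.refl R _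
    let f : M ⟶ sumObj N := transfer (b := fun _ => 1) e e₀ i (o i) 0
    let g : sumObj N ⟶ M := transfer (a := fun _ => 1) e₀ e i 0 (o i)
    have hfg : f ≫ g = T i (o i) (o i) := transfer_comp (b := fun _ => 1) e e₀ e i (o i) 0 (o i)
    refine Nat.card_le_card_of_injective
      (fun x : B i => (F.obj.map f x.1.1, G.obj.map f x.1.2)) fun x y hxy => Subtype.ext ?_
    have h1 : ∀ x : B i, (F.obj.map g (F.obj.map f x.1.1), G.obj.map g (G.obj.map f x.1.2)) =
        x.1 := fun x => by
      rw [← map_comp_apply, ← map_comp_apply, hfg]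
      exact x.2.2
    have hxy' := Prod.ext_iff.1 hxy
    rw [← h1 x, ← h1 y]
    exact Prod.ext (congrArg (F.obj.map g) hxy'.1) (congrArg (G.obj.map g) hxy'.2)
  let n : ∀ i, B i ↪ Fin (a i) := fun i => (hn i).some
  -- Every element of `B i` is placed in a copy of `N i` of its own, so matrix units can extract
  -- each of them from `x₀`.
  let x₀ : F.obj.obj M × G.obj.obj M := ∑ i, ∑ x : B i, T i (o i) (n i x) • x.1
  have hx₀ : ∀ i (x : B i), T i (n i x) (o i) • x₀ = x.1 := fun i x => by
    simp only [x₀, Finset.smul_sum]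
    rw [Finset.sum_eq_single i, Finset.sum_eq_single x]
    · rw [hT]
      exact x.2.2
    · intro y _ hy
      refine hT0 _ _ _ _ _ _ _ fun h => hy ((n i).injective ?_)
      exact eq_of_heq (Sigma.mk.inj_iff.1 h).2
    · simp
    · intro i' _ hi'
      exact Finset.sum_eq_zero fun y _ => hT0 _ _ _ _ _ _ _ fun h => hi' (Sigma.mk.inj_iff.1 h).1
    · simp
  refine ⟨x₀, le_antisymm ?_ fun l hl => ?_⟩
  · rw [Submodule.span_singleton_le_iff_mem]
    exact Submodule.sum_mem _ fun i _ => Submodule.sum_mem _ fun x _ => L.smul_mem _ x.2.1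
  · rw [← hsum l]
    refine Submodule.sum_mem _ fun i _ => Submodule.sum_mem _ fun j _ => ?_
    let x : B i := ⟨T i j (o i) • l, L.smul_mem _ hl, hT _ _ _ _ _⟩
    rw [← hT i j (o i) j l, show T i j (o i) • l = x.1 from rfl, ← hx₀ i x]
    exact Submodule.smul_mem _ _ (Submodule.smul_mem _ _ (Submodule.mem_span_singleton_self x₀))

end Large

/-! ### Cutting down kernels in left ideals of endomorphisms. -/

section KernelReduction

variable {Γ K V W : Type*} [Group Γ] [Finite Γ] [Field K] [CharZero K] [AddCommGroup V] [Module K V]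
  [AddCommGroup W] [Module K W] {ρ : Representation K Γ V} {σ : Representation K Γ W}

/-- In a left ideal of endomorphisms of a representation that contains all endomorphisms factoring
through `ψ`, the kernel of an element can be cut down to its intersection with that of `ψ`. -/
theorem exists_ker_eq_inf {I : Submodule K (V →ₗ[K] V)}
    (hI : ∀ (y : ρ.IntertwiningMap ρ), ∀ T ∈ I, y.toLinearMap ∘ₗ T ∈ I) (p : ρ.IntertwiningMap ρ)
    (hp : p.toLinearMap ∈ I) (ψ : ρ.IntertwiningMap σ)
    (hψ : ∀ χ : σ.IntertwiningMap ρ, χ.toLinearMap ∘ₗ ψ.toLinearMap ∈ I) :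
    ∃ p' : ρ.IntertwiningMap ρ, p'.toLinearMap ∈ I ∧
      ∀ x, p' x = 0 ↔ p x = 0 ∧ ψ x = 0 := by
  obtain ⟨g, hg⟩ := exists_quasiInverse p
  -- `e` is a projection onto the kernel of `p`. In `p'` below, the first term detects `p x`, and
  -- the second detects `ψ x` once `p x = 0`.
  let e : ρ.IntertwiningMap ρ := Representation.IntertwiningMap.id _ - g.comp p
  have he : ∀ z, e z = z - g (p z) := fun z => rfl
  obtain ⟨h, hh⟩ := exists_quasiInverse (ψ.comp e)
  replace hh : ∀ z, ψ (e (h (ψ (e z)))) = ψ (e z) := hh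
  let p' : ρ.IntertwiningMap ρ := g.comp p + (e.comp h).comp (ψ.comp e)
  have hp'z : ∀ z, p' z = g (p z) + e (h (ψ (e z))) := fun z => rfl
  refine ⟨p', ?_, fun x => ⟨fun hx => ?_, fun ⟨h1, h2⟩ => ?_⟩⟩
  · have : p'.toLinearMap = g.toLinearMap ∘ₗ p.toLinearMap +
        ((e.comp h).toLinearMap ∘ₗ ψ.toLinearMap -
          (((e.comp h).comp ψ).comp g).toLinearMap ∘ₗ p.toLinearMap) := by
      refine LinearMap.ext fun z => ?_
      change g (p z) + e (h (ψ (z - g (p z)))) =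
        g (p z) + (e (h (ψ z)) - e (h (ψ (g (p z)))))
      simp only [map_sub]
    rw [this]
    exact I.add_mem (hI g _ hp) (I.sub_mem (hψ _) (hI _ _ hp))
  · have h1 : p (p' x) = 0 := by rw [hx, map_zero]
    rw [hp'z, map_add, hg, he (h (ψ (e x))), map_sub, hg, sub_self, add_zero] at h1
    have h3 : e x = x := by rw [he, h1, map_zero, sub_zero]
    have h4 := hh x
    rw [hp'z, h1, map_zero, zero_add] at hx
    rw [hx, map_zero, h3] at h4
    exact ⟨h1, h4.symm⟩
  · have h3 : e x = x := by rw [he, h1, map_zero, sub_zero]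
    rw [hp'z, h1, map_zero, zero_add, h3, h2, map_zero, map_zero]

end KernelReduction

/-! ### Linear independence of relations. -/

section Independence

/-- A combination of members of a linearly independent family that lies in the span of other
members is trivial. -/
theorem eq_zero_of_linearCombination_mem_span {ι κ K V : Type*} [Field K] [AddCommGroup V]
    [Module K V] {v : κ → V} (hv : LinearIndependent K v) {f : ι → κ} (hf : Function.Injective f)
    {s : Set κ} (hs : ∀ i, f i ∉ s) {c : ι →₀ K}
    (hc : Finsupp.linearCombination K (fun i => v (f i)) c ∈ Submodule.span K (v '' s)) :
    c = 0 := by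
  have hrange : Finsupp.linearCombination K (fun i => v (f i)) c ∈
      Submodule.span K (v '' Set.range f) := by
    rw [← Set.range_comp]
    exact Finsupp.mem_span_range_iff_exists_finsupp.2 ⟨c, rfl⟩
  have hdisj : Disjoint (Set.range f) s := by
    rw [Set.disjoint_left]
    rintro _ ⟨i, rfl⟩
    exact hs i
  exact linearIndependent_iff.1 (hv.comp f hf) c
    (Submodule.disjoint_def.1 (hv.disjoint_span_image hdisj) _ hrange hc)

/-- If all submodules of `V × W` are cyclic, then a combination of maps defined by linear relations
that lies in the span of the maps defined by other relations is trivial. -/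
theorem eq_zero_of_linearCombination_relMap_mem_span {ι S V W : Type*} [Ring S]
    [AddCommGroup V] [Module S V] [AddCommGroup W] [Module S W] [Finite V] [Finite W]
    {K : Type*} [Field K] (h : ∀ L : Submodule S (V × W), ∃ x, Submodule.span S {x} = L)
    {f : ι → Submodule S (V × W)} (hf : Function.Injective f)
    {s : Set (Submodule S (V × W))} (hs : ∀ i, f i ∉ s) {c : ι →₀ K}
    (hc : Finsupp.linearCombination K (fun i => relMap K (f i)) c ∈
      Submodule.span K (relMap K '' s)) : c = 0 := by
  refine eq_zero_of_linearCombination_mem_span (linearIndependent_submoduleIndicator S K h) hf hs ?_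
  have h1 : Submodule.span K (relMap K '' s) =
      (Submodule.span K (submoduleIndicator K '' s)).map (kernelMap K) := by
    rw [Submodule.map_span, ← Set.image_comp]
    rfl
  have h2 : Finsupp.linearCombination K (fun i => relMap K (f i)) c =
      kernelMap K (Finsupp.linearCombination K (fun i => submoduleIndicator K (f i)) c) := by
    rw [Finsupp.apply_linearCombination]
    rfl
  rw [h1, h2] at hc
  obtain ⟨y, hy, hyc⟩ := hc
  rwa [kernelMap_injective K hyc] at hy

end Independence

/-! ### Maps through smaller functors and injectivity. -/

section Injectivity

variable {R : Type v} [Ring R] {k : ℕ} {N : Fin k → ModuleCat.{w} R}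
  {A : Type u} [CommRing A] [Algebra A R]
  (K : Type s) [Field K] (F : FunctorCat.{u, v, w, t} A N) {M : SumCat N} {a : Fin k → ℕ}

variable (M) in
/-- The span of the endomorphisms of `K F(M)` that factor through `K G(M)` for some `G ≺ F`. -/
noncomputable def belowSpan : Submodule K ((F.obj.obj M →₀ K) →ₗ[K] (F.obj.obj M →₀ K)) :=
  Submodule.span K {T | ∃ G : FunctorCat.{u, v, w, t} A N, StrictlyBelow G F ∧
    ∃ (ψ : (permRep K F M).IntertwiningMap (permRep K G M))
      (χ : (permRep K G M).IntertwiningMap (permRep K F M)),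
      χ.toLinearMap ∘ₗ ψ.toLinearMap = T}

variable {K F}

theorem comp_mem_belowSpan (y : (permRep K F M).IntertwiningMap (permRep K F M))
    {T : (F.obj.obj M →₀ K) →ₗ[K] (F.obj.obj M →₀ K)} (hT : T ∈ belowSpan K F M) :
    y.toLinearMap ∘ₗ T ∈ belowSpan K F M := by
  induction hT using Submodule.span_induction with
  | mem T h =>
    obtain ⟨G, hG, ψ, χ, rfl⟩ := h
    exact Submodule.subset_span ⟨G, hG, ψ, y.comp χ, rfl⟩
  | zero => rw [LinearMap.comp_zero]; exact Submodule.zero_mem _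
  | add T₁ T₂ _ _ h₁ h₂ => rw [LinearMap.comp_add]; exact Submodule.add_mem _ h₁ h₂
  | smul c T _ h => rw [LinearMap.comp_smul]; exact Submodule.smul_mem _ c h

/-- An endomorphism of `K F(M)` that vanishes on `\overline{K F(M)}` is a sum of endomorphisms that
factor through smaller functors. -/
theorem mem_belowSpan [CharZero K] [Finite (Aut M)]
    (y : (permRep K F M).IntertwiningMap (permRep K F M))
    (hy : ∀ x ∈ (barRep K F M).toSubmodule, y x = 0) : y.toLinearMap ∈ belowSpan K F M := by
  -- For `p` with minimal kernel, all maps to smaller functors vanish on `ker p`, since otherwise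
  -- `exists_ker_eq_inf` would shrink it. So `ker p` lies in the largest subrepresentation, where
  -- `y` vanishes, and `y` factors through `p`.
  obtain ⟨p, hp, hmin⟩ := WellFounded.has_min
    (r := InvImage (· < ·) fun p : (permRep K F M).IntertwiningMap (permRep K F M) =>
      LinearMap.ker p.toLinearMap) (InvImage.wf _ wellFounded_lt)
    {p | p.toLinearMap ∈ belowSpan K F M} ⟨0, (belowSpan K F M).zero_mem⟩
  obtain ⟨g, hg⟩ := exists_quasiInverse p
  have hker : NoMapsFromBelow p.ker := by
    rw [noMapsFromBelow_iff]
    intro G hG ψ x hx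
    by_contra hne
    have hχ : ∀ χ : (permRep K G M).IntertwiningMap (permRep K F M),
        χ.toLinearMap ∘ₗ ψ.toLinearMap ∈ belowSpan K F M :=
      fun χ => Submodule.subset_span ⟨G, hG, ψ, χ, rfl⟩
    obtain ⟨p', hp', hker'⟩ := exists_ker_eq_inf (I := belowSpan K F M)
      (fun y T hT => comp_mem_belowSpan y hT) p hp ψ hχ
    refine hmin p' hp' (lt_of_le_of_ne (fun z hz => ((hker' z).1 hz).1) fun heq => ?_)
    have hx' : x ∈ LinearMap.ker p'.toLinearMap := by
      rw [show LinearMap.ker p'.toLinearMap = LinearMap.ker p.toLinearMap from heq]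
      exact hx
    exact hne ((hker' x).1 hx').2
  have hle := le_barRep hker
  have h : y.toLinearMap = (y.comp g).toLinearMap ∘ₗ p.toLinearMap := by
    refine LinearMap.ext fun z => ?_
    have h1 : z - g (p z) ∈ (barRep K F M).toSubmodule := by
      refine hle ?_
      change p (z - g (p z)) = 0
      rw [map_sub, hg, sub_self]
    have h2 := hy _ h1
    rw [map_sub, sub_eq_zero] at h2
    exact h2
  rw [h]
  exact comp_mem_belowSpan _ hp

variable (F M) in
/-- The linear relations on `F(M)` that are not graphs of automorphisms of `F`. -/
def nonGraphs : Set (Submodule (End M) (F.obj.obj M × F.obj.obj M)) :=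
  {L | ¬ ∃ α : Aut F, LinearMap.graph (appEnd α.hom M) = L}

theorem mem_graph_appEnd {G : FunctorCat.{u, v, w, t} A N} {α : F ⟶ G} {x : F.obj.obj M}
    {y : G.obj.obj M} : (x, y) ∈ LinearMap.graph (appEnd α M) ↔ y = α.hom.app M x := Iff.rfl

/-- If the graph of an automorphism factored through `G(M)`, then `G(M)` would have at least as many
elements as `F(M)`. The maps realising `G` as a subquotient of `F` would be bijective at `M`, hence
everywhere because `M` involves every `N i`, giving `G ≅ F`. -/
theorem relComp_mem_nonGraphs (hM : HasMultiplicities N M.obj a) (ha : ∀ i, 0 < a i)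
    {G : FunctorCat.{u, v, w, t} A N} (hG : StrictlyBelow G F)
    (L : Submodule (End M) (F.obj.obj M × G.obj.obj M))
    (L' : Submodule (End M) (G.obj.obj M × F.obj.obj M)) : relComp L L' ∈ nonGraphs F M := by
  rintro ⟨α, hα⟩
  obtain ⟨⟨H, i, p, hi, hp⟩, hne⟩ := hG
  have hinj : Function.Injective (α.hom.hom.app M) := by
    refine Function.LeftInverse.injective (g := α.inv.hom.app M) fun x => ?_
    exact congrArg (fun β : F ⟶ F => β.hom.app M x) α.hom_inv_id
  have hmem : ∀ x y, (x, y) ∈ relComp L L' ↔ y = α.hom.hom.app M x := fun x y => by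
    rw [← hα, mem_graph_appEnd]
  choose s hs using fun x => mem_relComp.1 ((hmem x _).2 rfl)
  have hcard : Nat.card (F.obj.obj M) ≤ Nat.card (G.obj.obj M) := by
    -- If `x` and `y` share an intermediate element, then `x` is also related to the image of `y`
    -- under `α`.
    refine Nat.card_le_card_of_injective s fun x y hxy => hinj ?_
    have h1 := (hs x).1
    have h2 := (hs y).2
    rw [← hxy] at h2
    exact ((hmem x (α.hom.hom.app M y)).1 ((mem_relComp (p := (x, _))).2 ⟨s x, h1, h2⟩)).symm
  obtain ⟨hiM, hpM⟩ := bijective_of_card_le (hi M) (hp M) hcard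
  let ei : H ≅ F := isoOfBijective i fun X => ⟨hi X, app_surjective hM ha hiM.2 X⟩
  let ep : H ≅ G := isoOfBijective p fun X => ⟨app_injective hM ha hpM.1 X, hp X⟩
  exact hne ⟨ep.symm ≪≫ ei⟩

theorem belowSpan_le [Finite (End M)] (hM : HasMultiplicities N M.obj a) (ha : ∀ i, 0 < a i) :
    belowSpan K F M ≤ Submodule.span K (relMap K '' nonGraphs F M) := by
  refine Submodule.span_le.2 ?_
  rintro _ ⟨G, hG, ψ, χ, rfl⟩
  have hψ := intertwiningMap_mem_span ψ
  have hχ := intertwiningMap_mem_span χ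
  change χ.toLinearMap ∘ₗ ψ.toLinearMap ∈ Submodule.span K (relMap K '' nonGraphs F M)
  generalize ψ.toLinearMap = T at hψ
  generalize χ.toLinearMap = T' at hχ
  induction hψ using Submodule.span_induction with
  | mem T h =>
    obtain ⟨L, rfl⟩ := h
    induction hχ using Submodule.span_induction with
    | mem T' h' =>
      obtain ⟨L', rfl⟩ := h'
      rw [relMap_comp]
      exact Submodule.smul_mem _ _ (Submodule.subset_span
        ⟨_, relComp_mem_nonGraphs hM ha hG L L', rfl⟩)
    | zero => rw [LinearMap.zero_comp]; exact Submodule.zero_mem _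
    | add T₁ T₂ _ _ h₁ h₂ => rw [LinearMap.add_comp]; exact Submodule.add_mem _ h₁ h₂
    | smul c T _ h => rw [LinearMap.smul_comp]; exact Submodule.smul_mem _ c h
  | zero => rw [LinearMap.comp_zero]; exact Submodule.zero_mem _
  | add T₁ T₂ _ _ h₁ h₂ => rw [LinearMap.comp_add]; exact Submodule.add_mem _ h₁ h₂
  | smul c T _ h => rw [LinearMap.comp_smul]; exact Submodule.smul_mem _ c h

theorem Phi_apply (z : MonoidAlgebra K (Aut F)) (x : (barRep K F M).toSubmodule) :
    (Phi K F M z x).1 =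
      Finsupp.linearCombination K (fun α : Aut F => pushforward K α.hom M x.1) z.coeff := by
  induction z using MonoidAlgebra.induction_linear with
  | zero =>
    rw [map_zero, MonoidAlgebra.coeff_zero, map_zero]
    rfl
  | add z₁ z₂ h₁ h₂ =>
    rw [map_add, MonoidAlgebra.coeff_add, map_add, ← h₁, ← h₂]
    rfl
  | single α c =>
    rw [Phi_single_apply, MonoidAlgebra.coeff_single, Finsupp.linearCombination_single]

theorem graph_injective (hM : HasMultiplicities N M.obj a) (ha : ∀ i, 0 < a i) :
    Function.Injective fun α : Aut F => LinearMap.graph (appEnd α.hom M) := by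
  intro α β h
  refine Iso.ext (hom_ext_of_app_eq hM ha fun x => ?_)
  have h1 : (x, appEnd α.hom M x) ∈ LinearMap.graph (appEnd α.hom M) := mem_graph_appEnd.2 rfl
  rw [show LinearMap.graph (appEnd α.hom M) = LinearMap.graph (appEnd β.hom M) from h] at h1
  exact mem_graph_appEnd.1 h1

theorem relMap_graph (α : F ⟶ F) :
    relMap K (LinearMap.graph (appEnd α M)) = (pushforward K α M).toLinearMap :=
  relMap_eq_pushforward fun _ _ => mem_graph_appEnd.trans eq_comm

variable (M) in
/-- The endomorphism of `K F(M)` defined by an element of the group algebra of `Aut(F)`. -/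
noncomputable def groupAlgebraMap (z : MonoidAlgebra K (Aut F)) :
    (permRep K F M).IntertwiningMap (permRep K F M) :=
  Finsupp.linearCombination K (fun α : Aut F => pushforward K α.hom M) z.coeff

theorem groupAlgebraMap_apply (z : MonoidAlgebra K (Aut F)) (x : F.obj.obj M →₀ K) :
    groupAlgebraMap M z x =
      Finsupp.linearCombination K (fun α : Aut F => pushforward K α.hom M x) z.coeff := by
  rw [groupAlgebraMap, Finsupp.linearCombination_apply, Finsupp.linearCombination_apply,
    Finsupp.sum, Finsupp.sum, Representation.IntertwiningMap.sum_apply]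
  rfl

theorem groupAlgebraMap_toLinearMap (z : MonoidAlgebra K (Aut F)) :
    (groupAlgebraMap M z).toLinearMap = Finsupp.linearCombination K
      (fun α : Aut F => relMap K (LinearMap.graph (appEnd α.hom M))) z.coeff := by
  rw [groupAlgebraMap, Finsupp.linearCombination_apply, Finsupp.linearCombination_apply,
    Finsupp.sum, Finsupp.sum, Representation.IntertwiningMap.toLinearMap_sum]
  exact Finset.sum_congr rfl fun α _ => by rw [relMap_graph]; rfl

/-- The difference of two elements with equal image acts on `K F(M)` as a combination of graphs of
automorphisms, and also lies in the span of non-graphs. -/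
theorem Phi_injective [CharZero K] [Finite (Aut M)] [Finite (End M)]
    (hM : HasMultiplicities N M.obj a)
    (ha : ∀ i, Nat.card (F.obj.obj (sumObj N) × F.obj.obj (sumObj N)) ≤ a i) :
    Function.Injective (Phi K F M) := by
  have hpos : ∀ i, 0 < a i := fun i => lt_of_lt_of_le Nat.card_pos (ha i)
  intro z₁ z₂ hz
  have hy0 : ∀ x ∈ (barRep K F M).toSubmodule, groupAlgebraMap M (z₁ - z₂) x = 0 := fun x hx => by
    rw [groupAlgebraMap_apply, MonoidAlgebra.coeff_sub, map_sub, ← Phi_apply z₁ ⟨x, hx⟩,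
      ← Phi_apply z₂ ⟨x, hx⟩, hz, sub_self]
  have hmem := belowSpan_le hM hpos (mem_belowSpan _ hy0)
  rw [groupAlgebraMap_toLinearMap] at hmem
  have h0 := eq_zero_of_linearCombination_relMap_mem_span (exists_span_singleton_eq hM ha)
    (graph_injective hM hpos) (s := nonGraphs F M) (fun α h => h ⟨α, rfl⟩) hmem
  rw [MonoidAlgebra.coeff_sub, sub_eq_zero] at h0
  exact MonoidAlgebra.coeff_injective h0

end Injectivity

/-! ### Finiteness of endomorphism rings and automorphism groups. -/

section Finiteness

variable {R : Type v} [Ring R] {k : ℕ} {N : Fin k → ModuleCat.{w} R}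

theorem finite_of_isSumOf (hfin : ∀ i, Finite (N i)) (M : SumCat N) : Finite M.obj := by
  obtain ⟨a, ⟨e⟩⟩ := M.property
  exact Finite.of_equiv _ e.symm.toEquiv

theorem finite_end (hfin : ∀ i, Finite (N i)) (M : SumCat N) : Finite (End M) := by
  have := finite_of_isSumOf hfin M
  exact Finite.of_injective (fun f : M ⟶ M => (f.hom.hom : M.obj → M.obj)) fun f g h =>
    hom_ext_apply (congrFun h)

theorem finite_aut (hfin : ∀ i, Finite (N i)) (M : SumCat N) : Finite (Aut M) := by
  have := finite_end hfin M
  exact Finite.of_injective (β := End M) (fun g : Aut M => g.hom) fun _ _ h => Iso.ext h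

end Finiteness

end FunctorMorphing

open FunctorMorphing IsLocalRing in
theorem theoremB
    {𝒪 : Type u} [CommRing 𝒪] [IsDomain 𝒪] [IsDiscreteValuationRing 𝒪]
    [IsAdicComplete (maximalIdeal 𝒪) 𝒪] [Finite (ResidueField 𝒪)] (ℓ : ℕ)
    {R : Type v} [Ring R] [Algebra (𝒪 ⧸ maximalIdeal 𝒪 ^ ℓ) R] [Finite R]
    {k : ℕ} (N : Fin k → ModuleCat.{w} R) (hfin : ∀ i, Finite (N i))
    (hind : ∀ i, Indecomposable (N i))
    (K : Type s) [Field K] [IsAlgClosed K] [CharZero K]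
    (F : FunctorCat.{u, v, w, t} (𝒪 ⧸ maximalIdeal 𝒪 ^ ℓ) N) :
    (∀ M : SumCat N,
      IsGreatest {W : Subrepresentation (permRep K F M) | NoMapsFromBelow W} (barRep K F M) ∧
      Function.Surjective (Phi K F M)) ∧
    ∃ c : ℕ, ∀ (M : SumCat N) (a : Fin k → ℕ), HasMultiplicities N M.obj a →
      (∀ i, c ≤ a i) → Function.Injective (Phi K F M) := by
  have hEnd := finite_end hfin
  have hAut := finite_aut hfin
  exact ⟨fun M => ⟨isGreatest_barRep, Phi_surjective⟩,
    -- The constant is the square of the order of `F(⊕ N i)`. It leaves room for each element of the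
    -- part of a submodule of `F(M) × F(M)` in one copy of `N i`, and it is positive.
    Nat.card (F.obj.obj (sumObj N) × F.obj.obj (sumObj N)), fun M a hM ha => Phi_injective hM ha⟩
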